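/- All vector spaces are over $\mathbb{C}$. A Lie superalgebra $\mathfrak{g}=\mathfrak{g}_{\bar0}\oplus\mathfrak{g}_{\bar1}$ is simple if it is not abelian and has no graded ideals other than $0$ and itself; all modules are $\mathbb{Z}_2$-graded, submodules are graded, $\cong$ between modules means an even isomorphism, and a module $M$ is trivial if $\mathfrak{g}\cdot M=0$. For $z\in\mathbb{Z}_2$, $\mathrm{Hom}_{\mathfrak{g}}(M,N)_z$ is the space of linear maps $f\colon M\to N$ of degree $z$ with $f(xv)=(-1)^{z|x|}xf(v)$ for homogeneous $x\in\mathfrak g$ and $v\in M$, and $H^1(\mathfrak{g},M)_z$ is the space of linear maps $f\colon\mathfrak{g}\to M$ of degree $z$ with $f([x,y])=(-1)^{z|x|}xf(y)-(-1)^{|y|(|x|+z)}yf(x)$ for homogeneous $x,y$, modulo the maps $x\mapsto(-1)^{z|x|}xv$ with $v\in M_z$; $\mathrm{Hom}_{\mathfrak g}(M,N)$ and $H^1(\mathfrak g,M)$ are the direct sums of their components of degrees $\bar0$ and $\bar1$. Let $\mathfrak{g}$ be a finite-dimensional simple Lie superalgebra (for example of type II, $\mathfrak{p}$, $\mathfrak{q}$,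 $H$, $S$ or $\tilde S$) and let $A$ be a finitely generated associative commutative $\mathbb{C}$-algebra with unit. The Lie superalgebra $\mathfrak{g}\otimes A$ has bracket $[x\otimes a,y\otimes b]=[x,y]\otimes ab$ and grading $(\mathfrak{g}\otimes A)_z=\mathfrak{g}_z\otimes A$. For a maximal ideal $\mathsf{m}$ of $A$, let $\mathrm{ev}_{\mathsf{m}}\colon\mathfrak{g}\otimes A\to\mathfrak{g}\otimes A/\mathsf{m}\cong\mathfrak{g}$ be the evaluation map. For irreducible finite-dimensional modules $M$ over $\mathfrak{g}^1$ and $N$ over $\mathfrak{g}^2$, the irreducible product $M\,\widehat\otimes\,N$ is the $(\mathfrak{g}^1\oplus\mathfrak{g}^2)$-module $M\otimes N$ if that is irreducible, and otherwise the submodule $\{t\in M\otimes N : \sqrt{-1}\,(\varphi_1\otimes\varphi_2)t=t\}$, where $\varphi_1\in\mathrm{End}_{\mathfrak{g}^1}(M)_{\bar1}$ and $\varphi_2\in\mathrm{End}_{\mathfrak{g}^2}(N)_{\bar1}$ satisfy $\varphi_1^2=\varphi_2^2=-1$ and $(\varphi_1\otimes\varphi_2)(v\otimes w)=(-1)^{|v|}\varphi_1v\otimes\varphi_2w$.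 For irreducible finite-dimensional $\mathfrak{g}$-modules $V_1,\dots,V_\ell$, the $\mathfrak{g}^{\oplus\ell}$-module $V_1\widehat\otimes\cdots\widehat\otimes V_\ell$ is formed iteratively, one factor at a time from the left, and, for distinct maximal ideals $\mathsf m_1,\dots,\mathsf m_\ell$ of $A$, $\widehat\bigotimes_{i=1}^{\ell}\mathrm{ev}_{\mathsf{m}_i}V_i$ denotes its pull-back along $(\mathrm{ev}_{\mathsf{m}_1},\dots,\mathrm{ev}_{\mathsf{m}_\ell})\colon\mathfrak{g}\otimes A\to\mathfrak{g}^{\oplus\ell}$. Let $V$ be a finite-dimensional irreducible $\mathfrak{g}\otimes A$-module, let $\ell$ be a positive integer, let $\mathsf{m}_1,\dots,\mathsf{m}_\ell$ be distinct maximal ideals of $A$, and let $V_1,\dots,V_\ell$ be finite-dimensional nontrivial irreducible $\mathfrak{g}$-modules such that $V\cong\widehat\bigotimes_{i=1}^{\ell}\mathrm{ev}_{\mathsf{m}_i}V_i$. If $\ell=1$, then, as $\mathbb{Z}_2$-graded vector spaces, $$H^1(\mathfrak{g}\otimes A,V)\;\cong\;H^1(\mathfrak{g},V_1)\oplus\mathrm{Hom}_{\mathfrak{g}}(\mathfrak{g},V_1)^{\oplus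 d},\qquad d=\dim_{A/\mathsf{m}_1}\mathsf{m}_1/\mathsf{m}_1^2,$$ where $\mathfrak{g}$ is regarded as its adjoint module. If $\ell>1$, then $H^1(\mathfrak{g}\otimes A,V)=0$. -/

import Mathlib

open scoped TensorProduct

universe u v w

noncomputable section

/-- The Koszul sign `(-1)^(i j)` for `i, j ∈ ℤ/2`. -/
def koszulSign (i j : ZMod 2) : ℂ := if i = 1 ∧ j = 1 then -1 else 1

theorem zmod_two_cases (i : ZMod 2) : i = 0 ∨ i = 1 := by
  revert i; decide

theorem zmod_one_add_one : (1 : ZMod 2) + 1 = 0 := by decide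

@[simp] theorem koszulSign_zero_left (i : ZMod 2) : koszulSign 0 i = 1 := by
  simp [koszulSign]

@[simp] theorem koszulSign_zero_right (i : ZMod 2) : koszulSign i 0 = 1 := by
  simp [koszulSign]

@[simp] theorem koszulSign_one_one : koszulSign 1 1 = -1 := by
  simp [koszulSign]

/-! ### Super vector spaces -/

/-- A complex super vector space: `V = V₀ ⊕ V₁`. -/
class SuperSpace (V : Type*) [AddCommGroup V] [Module ℂ V] where
  grade : ZMod 2 → Submodule ℂ V
  isCompl : IsCompl (grade 0) (grade 1)

namespace SuperSpace

section

variable (V : Type*) [AddCommGroup V] [Module ℂ V] [SuperSpace V]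

/-- The projection of `V` onto its homogeneous component of degree `i`. -/
def proj (i : ZMod 2) : V →ₗ[ℂ] V :=
  if i = 0 then Submodule.projection (grade 0) (grade 1) isCompl
  else Submodule.projection (grade 1) (grade 0) isCompl.symm

/-- The parity involution `v ↦ (-1)^|v| v`. -/
def parity : V →ₗ[ℂ] V := proj V 0 - proj V 1

end

variable {V : Type*} [AddCommGroup V] [Module ℂ V] [SuperSpace V]
variable {W : Type*} [AddCommGroup W] [Module ℂ W] [SuperSpace W]

theorem proj_mem (i : ZMod 2) (v : V) : proj V i v ∈ grade (V := V) i := by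
  rcases zmod_two_cases i with rfl | rfl
  · simp [proj]
  · simp [proj]

theorem proj_of_mem {i : ZMod 2} {v : V} (hv : v ∈ grade (V := V) i) : proj V i v = v := by
  rcases zmod_two_cases i with rfl | rfl
  · simpa [proj, Submodule.projection_eq_self_iff] using hv
  · simpa [proj, Submodule.projection_eq_self_iff] using hv

theorem proj_of_mem_ne {i j : ZMod 2} (hij : i ≠ j) {v : V} (hv : v ∈ grade (V := V) j) :
    proj V i v = 0 := by
  rcases zmod_two_cases i with rfl | rfl <;> rcases zmod_two_cases j with rfl | rfl
  · exact absurd rfl hij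
  · simpa [proj, Submodule.projection_apply_eq_zero_iff] using hv
  · simpa [proj, Submodule.projection_apply_eq_zero_iff] using hv
  · exact absurd rfl hij

theorem proj_add_proj (v : V) : proj V 0 v + proj V 1 v = v := by
  have := Submodule.projection_add_projection_eq_self (isCompl (V := V)) v
  simpa [proj] using this

theorem parity_of_mem {i : ZMod 2} {v : V} (hv : v ∈ grade (V := V) i) :
    parity V v = koszulSign i 1 • v := by
  rcases zmod_two_cases i with rfl | rfl
  · simp [parity, proj_of_mem hv, proj_of_mem_ne (i := 1) (by decide) hv]
  · simp [parity, proj_of_mem hv, proj_of_mem_ne (i := 0) (by decide) hv]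

/-- Induction over homogeneous vectors. -/
theorem homogeneous_induction {P : V → Prop} (hadd : ∀ a b, P a → P b → P (a + b))
    (hhom : ∀ i, ∀ a ∈ grade (V := V) i, P a) (v : V) : P v := by
  rw [← proj_add_proj v]
  exact hadd _ _ (hhom 0 _ (proj_mem 0 v)) (hhom 1 _ (proj_mem 1 v))

/-- Criterion: two subspaces spanning `V` on which an endomorphism acts by `1` and `-1`. -/
theorem isCompl_of_involution {U : Type*} [AddCommGroup U] [Module ℂ U] {P Q : Submodule ℂ U}
    (T : U →ₗ[ℂ] U) (hP : ∀ u ∈ P, T u = u) (hQ : ∀ u ∈ Q, T u = -u) (hPQ : ∀ u, u ∈ P ⊔ Q) :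
    IsCompl P Q := by
  constructor
  · rw [Submodule.disjoint_def]
    intro x h1 h2
    have h := (hP x h1).symm.trans (hQ x h2)
    have h2 : (2 : ℂ) • x = 0 := by rw [two_smul]; exact eq_neg_iff_add_eq_zero.mp h
    exact (smul_eq_zero.mp h2).resolve_left two_ne_zero
  · rw [codisjoint_iff, Submodule.eq_top_iff']
    exact hPQ

/-- The tensor product of super spaces: `(V ⊗ W)_k = ⨁_{i + j = k} V_i ⊗ W_j`. -/
def tensorGrade (V W : Type*) [AddCommGroup V] [Module ℂ V] [SuperSpace V]
    [AddCommGroup W] [Module ℂ W] [SuperSpace W] (k : ZMod 2) : Submodule ℂ (V ⊗[ℂ] W) :=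
  ⨆ i : ZMod 2, Submodule.map₂ (TensorProduct.mk ℂ V W) (grade i) (grade (k - i))

theorem tmul_mem_tensorGrade {i j : ZMod 2} {v : V} {w : W} (hv : v ∈ grade (V := V) i)
    (hw : w ∈ grade (V := W) j) : v ⊗ₜ[ℂ] w ∈ tensorGrade V W (i + j) := by
  refine Submodule.mem_iSup_of_mem i ?_
  refine Submodule.apply_mem_map₂ (TensorProduct.mk ℂ V W) hv ?_
  simpa using hw

theorem tensorGrade_le {k : ZMod 2} {S : Submodule ℂ (V ⊗[ℂ] W)}
    (h : ∀ i j, i + j = k → ∀ v ∈ grade (V := V) i, ∀ w ∈ grade (V := W) j, v ⊗ₜ[ℂ] w ∈ S) :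
    tensorGrade V W k ≤ S := by
  refine iSup_le fun i => Submodule.map₂_le.mpr fun v hv w hw => ?_
  exact h i (k - i) (by ring) v hv w hw

theorem tensor_parity {k : ZMod 2} {t : V ⊗[ℂ] W} (ht : t ∈ tensorGrade V W k) :
    TensorProduct.map (parity V) (parity W) t = koszulSign k 1 • t := by
  have : tensorGrade V W k ≤ LinearMap.eqLocus (TensorProduct.map (parity V) (parity W))
      (koszulSign k 1 • LinearMap.id) := by
    refine tensorGrade_le fun i j hij v hv w hw => ?_
    subst hij
    rw [LinearMap.mem_eqLocus]
    simp only [TensorProduct.map_tmul, parity_of_mem hv, parity_of_mem hw, LinearMap.smul_apply,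
      LinearMap.id_apply, TensorProduct.smul_tmul_smul]
    rcases zmod_two_cases i with rfl | rfl <;> rcases zmod_two_cases j with rfl | rfl <;>
      simp [zmod_one_add_one]
  exact this ht

instance tensorSuperSpace : SuperSpace (V ⊗[ℂ] W) where
  grade := tensorGrade V W
  isCompl := by
    refine isCompl_of_involution (TensorProduct.map (parity V) (parity W))
      (fun u hu => by simpa using tensor_parity hu)
      (fun u hu => by simpa using tensor_parity hu) fun u => ?_
    have key : ∀ k, tensorGrade V W k ≤ tensorGrade V W 0 ⊔ tensorGrade V W 1 := by
      intro k
      rcases zmod_two_cases k with rfl | rfl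
      · exact le_sup_left
      · exact le_sup_right
    induction u with
    | zero => exact zero_mem _
    | add a b ha hb => exact add_mem ha hb
    | tmul v w =>
      induction v using homogeneous_induction with
      | hadd a b ha hb => rw [TensorProduct.add_tmul]; exact add_mem ha hb
      | hhom i a ha =>
        induction w using homogeneous_induction with
        | hadd b c hb hc => rw [TensorProduct.tmul_add]; exact add_mem hb hc
        | hhom j b hb => exact key _ (tmul_mem_tensorGrade ha hb)

end SuperSpace

open SuperSpace

/-! ### Lie superalgebras -/

/-- A complex Lie superalgebra. -/
class LieSuperalgebra (L : Type*) [AddCommGroup L] [Module ℂ L] extends SuperSpace L where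
  bracket : L →ₗ[ℂ] L →ₗ[ℂ] L
  bracket_mem : ∀ i j, ∀ x ∈ grade i, ∀ y ∈ grade j, bracket x y ∈ grade (i + j)
  bracket_skew : ∀ i j, ∀ x ∈ grade i, ∀ y ∈ grade j,
    bracket x y = -(koszulSign i j • bracket y x)
  bracket_jacobi : ∀ i j, ∀ x ∈ grade i, ∀ y ∈ grade j, ∀ z,
    bracket x (bracket y z) = bracket (bracket x y) z + koszulSign i j • bracket y (bracket x z)

namespace LieSuperalgebra

/-- A subspace of a super space is graded if it contains the homogeneous components of its
elements. -/
def IsGraded {V : Type*} [AddCommGroup V] [Module ℂ V] [SuperSpace V] (S : Submodule ℂ V) : Prop :=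
  ∀ i, ∀ v ∈ S, proj V i v ∈ S

/-- A Lie superalgebra is simple if it is not abelian and has no graded ideals other than `0` and
itself. -/
def IsSimple (L : Type*) [AddCommGroup L] [Module ℂ L] [LieSuperalgebra L] : Prop :=
  (∃ x y : L, bracket x y ≠ 0) ∧
    ∀ S : Submodule ℂ L, IsGraded S → (∀ x, ∀ y ∈ S, bracket x y ∈ S) → S = ⊥ ∨ S = ⊤

/-- Homomorphisms of Lie superalgebras. -/
structure Hom (L L' : Type*) [AddCommGroup L] [Module ℂ L] [LieSuperalgebra L]
    [AddCommGroup L'] [Module ℂ L'] [LieSuperalgebra L'] where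
  toLinearMap : L →ₗ[ℂ] L'
  map_mem : ∀ i, ∀ x ∈ grade (V := L) i, toLinearMap x ∈ grade (V := L') i
  map_bracket : ∀ x y, toLinearMap (bracket x y) = bracket (toLinearMap x) (toLinearMap y)

/-- The direct sum `𝔤^{⊕ n}`. -/
instance piInstance (L : Type*) [AddCommGroup L] [Module ℂ L] [LieSuperalgebra L] (n : ℕ) :
    LieSuperalgebra (Fin n → L) where
  grade i := Submodule.pi Set.univ fun _ => grade i
  isCompl := by
    refine isCompl_of_involution (LinearMap.pi fun k => (parity L).comp (LinearMap.proj k))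
      (fun u hu => ?_) (fun u hu => ?_) fun u => ?_
    · ext k
      simpa using parity_of_mem (Submodule.mem_pi.mp hu k (Set.mem_univ k))
    · ext k
      simpa using parity_of_mem (Submodule.mem_pi.mp hu k (Set.mem_univ k))
    · refine Submodule.mem_sup.mpr ⟨fun k => proj L 0 (u k), ?_, fun k => proj L 1 (u k), ?_, ?_⟩
      · exact Submodule.mem_pi.mpr fun k _ => proj_mem 0 _
      · exact Submodule.mem_pi.mpr fun k _ => proj_mem 1 _
      · ext k
        exact proj_add_proj (u k)
  bracket := LinearMap.mk₂ ℂ (fun x y k => bracket (x k) (y k))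
    (fun _ _ _ => by ext; simp) (fun _ _ _ => by ext; simp)
    (fun _ _ _ => by ext; simp) (fun _ _ _ => by ext; simp)
  bracket_mem i j x hx y hy := Submodule.mem_pi.mpr fun k hk =>
    bracket_mem i j _ (Submodule.mem_pi.mp hx k hk) _ (Submodule.mem_pi.mp hy k hk)
  bracket_skew i j x hx y hy := by
    ext k
    exact bracket_skew i j _ (Submodule.mem_pi.mp hx k trivial) _ (Submodule.mem_pi.mp hy k trivial)
  bracket_jacobi i j x hx y hy z := by
    ext k
    exact bracket_jacobi i j _ (Submodule.mem_pi.mp hx k trivial) _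
      (Submodule.mem_pi.mp hy k trivial) (z k)

/-- The `k`-th projection `𝔤^{⊕ n} → 𝔤`. -/
def projHom (L : Type*) [AddCommGroup L] [Module ℂ L] [LieSuperalgebra L] {n : ℕ} (k : Fin n) :
    Hom (Fin n → L) L where
  toLinearMap := LinearMap.proj k
  map_mem _ _ hx := Submodule.mem_pi.mp hx k trivial
  map_bracket _ _ := rfl

/-- The projection of `𝔤^{⊕ (n + 1)} = 𝔤^{⊕ n} ⊕ 𝔤` onto `𝔤^{⊕ n}`. -/
def initHom (L : Type*) [AddCommGroup L] [Module ℂ L] [LieSuperalgebra L] (n : ℕ) :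
    Hom (Fin (n + 1) → L) (Fin n → L) where
  toLinearMap := LinearMap.pi fun k => LinearMap.proj k.castSucc
  map_mem _ _ hx := Submodule.mem_pi.mpr fun k _ => Submodule.mem_pi.mp hx k.castSucc trivial
  map_bracket _ _ := rfl

end LieSuperalgebra

open LieSuperalgebra

/-! ### Map superalgebras -/

section MapSuperalgebra

variable (L : Type u) [AddCommGroup L] [Module ℂ L] [LieSuperalgebra L]
variable (A : Type w) [CommRing A] [Algebra ℂ A]

/-- The map superalgebra `𝔤 ⊗ A`, as a type of its own (so that its grading is not
confused with the grading of a tensor product of two super spaces). -/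
def MapSuperalgebra : Type (max u w) := L ⊗[ℂ] A

namespace MapSuperalgebra

instance : AddCommGroup (MapSuperalgebra L A) := inferInstanceAs (AddCommGroup (L ⊗[ℂ] A))

instance : Module ℂ (MapSuperalgebra L A) := inferInstanceAs (Module ℂ (L ⊗[ℂ] A))

/-- The pure tensor `x ⊗ a`, as a bilinear map. -/
def mk : L →ₗ[ℂ] A →ₗ[ℂ] MapSuperalgebra L A := TensorProduct.mk ℂ L A

/-- `(𝔤 ⊗ A)_z = 𝔤_z ⊗ A`. -/
def gradeMap (z : ZMod 2) : Submodule ℂ (MapSuperalgebra L A) :=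
  Submodule.map₂ (mk L A) (grade z) ⊤

/-- The bracket with `[x ⊗ a, y ⊗ b] = [x, y] ⊗ a b`. -/
def bracketMap :
    MapSuperalgebra L A →ₗ[ℂ] MapSuperalgebra L A →ₗ[ℂ] MapSuperalgebra L A :=
  TensorProduct.map₂ (bracket (L := L)) (LinearMap.mul ℂ A)

theorem bracketMap_mk (x y : L) (a b : A) :
    bracketMap L A (mk L A x a) (mk L A y b) = mk L A (bracket x y) (a * b) :=
  rfl

variable {L A}

theorem induction_on {P : MapSuperalgebra L A → Prop} (hzero : P 0)
    (hadd : ∀ s t, P s → P t → P (s + t)) (hmk : ∀ x a, P (mk L A x a))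
    (t : MapSuperalgebra L A) : P t :=
  TensorProduct.induction_on (motive := P) t hzero hmk hadd

theorem grade_induction {z : ZMod 2} {P : MapSuperalgebra L A → Prop} (hzero : P 0)
    (hadd : ∀ s t, P s → P t → P (s + t))
    (hmk : ∀ x ∈ grade (V := L) z, ∀ a, P (mk L A x a)) {t : MapSuperalgebra L A}
    (ht : t ∈ gradeMap L A z) : P t := by
  rw [gradeMap, Submodule.map₂_eq_span_image2] at ht
  have key : ∀ c : ℂ, P (c • t) := by
    induction ht using Submodule.span_induction with
    | mem s hs =>
      obtain ⟨x, hx, a, -, rfl⟩ := hs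
      intro c
      have h : c • mk L A x a = mk L A x (c • a) := (map_smul (mk L A x) c a).symm
      rw [h]
      exact hmk x hx _
    | zero => intro c; simpa using hzero
    | add s s' _ _ hs hs' => intro c; rw [smul_add]; exact hadd _ _ (hs c) (hs' c)
    | smul d s _ hs => intro c; rw [smul_smul]; exact hs _
  simpa using key 1

theorem mk_mem_gradeMap {z : ZMod 2} {x : L} (hx : x ∈ grade (V := L) z) (a : A) :
    mk L A x a ∈ gradeMap L A z :=
  Submodule.apply_mem_map₂ _ hx Submodule.mem_top

variable (L A)

instance : LieSuperalgebra (MapSuperalgebra L A) where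
  grade := gradeMap L A
  isCompl := by
    have hT : ∀ z, ∀ u ∈ gradeMap L A z, (parity L).rTensor A u = koszulSign z 1 • u := by
      intro z u hu
      refine grade_induction (P := fun u => (parity L).rTensor A u = koszulSign z 1 • u)
        ?_ ?_ ?_ hu
      · rw [smul_zero]; exact map_zero _
      · intro s t hs ht
        rw [smul_add, ← hs, ← ht]; exact map_add _ _ _
      · intro x hx a
        refine (LinearMap.rTensor_tmul ..).trans ?_
        rw [parity_of_mem hx]
        exact TensorProduct.smul_tmul' ..
    refine isCompl_of_involution (U := MapSuperalgebra L A) ((parity L).rTensor A)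
      (fun u hu => (hT 0 u hu).trans (by rw [koszulSign_zero_left, one_smul]))
      (fun u hu => (hT 1 u hu).trans (by rw [koszulSign_one_one, neg_one_smul]))
      fun u => ?_
    induction u using induction_on with
    | hzero => exact zero_mem _
    | hadd s t hs ht => exact add_mem hs ht
    | hmk x a =>
      rw [← proj_add_proj x, map_add, LinearMap.add_apply]
      exact Submodule.add_mem_sup (mk_mem_gradeMap (proj_mem 0 x) a)
        (mk_mem_gradeMap (proj_mem 1 x) a)
  bracket := bracketMap L A
  bracket_mem i j s hs t ht := by
    refine grade_induction (P := fun s => bracketMap L A s t ∈ gradeMap L A (i + j)) ?_ ?_ ?_ hs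
    · simp
    · intro s s' h h'; rw [map_add, LinearMap.add_apply]; exact add_mem h h'
    · intro x hx a
      refine grade_induction
        (P := fun t => bracketMap L A (mk L A x a) t ∈ gradeMap L A (i + j)) ?_ ?_ ?_ ht
      · simp
      · intro s s' h h'; rw [map_add]; exact add_mem h h'
      · intro y hy b
        rw [bracketMap_mk]
        exact mk_mem_gradeMap (LieSuperalgebra.bracket_mem i j x hx y hy) _
  bracket_skew i j s hs t ht := by
    refine grade_induction
      (P := fun s => bracketMap L A s t = -(koszulSign i j • bracketMap L A t s)) ?_ ?_ ?_ hs
    · simp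
    · intro s s' h h'
      simp only [map_add, LinearMap.add_apply, h, h', smul_add, neg_add]
    · intro x hx a
      refine grade_induction (P := fun t => bracketMap L A (mk L A x a) t =
        -(koszulSign i j • bracketMap L A t (mk L A x a))) ?_ ?_ ?_ ht
      · simp
      · intro s s' h h'
        simp only [map_add, LinearMap.add_apply, h, h', smul_add, neg_add]
      · intro y hy b
        rw [bracketMap_mk, bracketMap_mk, LieSuperalgebra.bracket_skew i j x hx y hy, mul_comm b a]
        simp
  bracket_jacobi i j s hs t ht r := by
    refine grade_induction (P := fun s => bracketMap L A s (bracketMap L A t r) =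
      bracketMap L A (bracketMap L A s t) r + koszulSign i j •
        bracketMap L A t (bracketMap L A s r)) ?_ ?_ ?_ hs
    · simp
    · intro s s' h h'
      simp only [map_add, LinearMap.add_apply, h, h', smul_add]
      abel
    · intro x hx a
      refine grade_induction (P := fun t => bracketMap L A (mk L A x a) (bracketMap L A t r) =
        bracketMap L A (bracketMap L A (mk L A x a) t) r + koszulSign i j •
          bracketMap L A t (bracketMap L A (mk L A x a) r)) ?_ ?_ ?_ ht
      · simp
      · intro s s' h h'
        simp only [map_add, LinearMap.add_apply, h, h', smul_add]
        abel
      · intro y hy b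
        induction r using induction_on with
        | hzero => simp
        | hadd s s' h h' =>
          simp only [map_add, h, h', smul_add]
          abel
        | hmk z c =>
          simp only [bracketMap_mk]
          rw [LieSuperalgebra.bracket_jacobi i j x hx y hy z, mul_assoc a b c,
            mul_left_comm b a c]
          simp

/-- The residue field of a finitely generated `ℂ`-algebra at a maximal ideal is `ℂ`. -/
theorem residue_bijective [Algebra.FiniteType ℂ A] (m : MaximalSpectrum A) :
    Function.Bijective (Algebra.ofId ℂ (A ⧸ m.asIdeal)) := by
  have := m.isMaximal
  let _ : Field (A ⧸ m.asIdeal) := Ideal.Quotient.field m.asIdeal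
  have : Algebra.FiniteType ℂ (A ⧸ m.asIdeal) := inferInstance
  have : Module.Finite ℂ (A ⧸ m.asIdeal) := finite_of_finite_type_of_isJacobsonRing ℂ _
  exact IsAlgClosed.algebraMap_bijective_of_isIntegral

variable {A}

/-- The character `A → A / m ≅ ℂ` of a maximal ideal `m`. -/
def residue [Algebra.FiniteType ℂ A] (m : MaximalSpectrum A) : A →ₐ[ℂ] ℂ :=
  (AlgEquiv.ofBijective _ (residue_bijective A m)).symm.toAlgHom.comp
    (Ideal.Quotient.mkₐ ℂ m.asIdeal)

variable (A) in
/-- The linear map `x ⊗ a ↦ χ(a) x` attached to a character `χ` of `A`. -/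
def evalLin (χ : A →ₐ[ℂ] ℂ) : MapSuperalgebra L A →ₗ[ℂ] L :=
  TensorProduct.lift (LinearMap.flip ((LinearMap.lsmul ℂ L).comp χ.toLinearMap))

theorem evalLin_mk (χ : A →ₐ[ℂ] ℂ) (x : L) (a : A) : evalLin L A χ (mk L A x a) = χ a • x := by
  simp only [evalLin, mk]
  exact TensorProduct.lift.tmul ..

/-- The evaluation map `ev_m : 𝔤 ⊗ A → 𝔤 ⊗ A / m ≅ 𝔤`. -/
def evalHom [Algebra.FiniteType ℂ A] (m : MaximalSpectrum A) : Hom (MapSuperalgebra L A) L where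
  toLinearMap := evalLin L A (residue m)
  map_mem z t ht := by
    refine grade_induction (P := fun t => evalLin L A (residue m) t ∈ grade z) ?_ ?_ ?_ ht
    · simp
    · intro s s' h h'; rw [map_add]; exact add_mem h h'
    · intro x hx a; rw [evalLin_mk]; exact Submodule.smul_mem _ _ hx
  map_bracket s t := by
    change evalLin L A (residue m) (bracketMap L A s t) = _
    induction s using induction_on with
    | hzero => simp
    | hadd s s' h h' => simp only [map_add, LinearMap.add_apply, h, h']
    | hmk x a =>
      induction t using induction_on with
      | hzero => simp
      | hadd s s' h h' => simp only [map_add, h, h']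
      | hmk y b =>
        simp only [bracketMap_mk, evalLin_mk, map_mul, mul_smul, map_smul, LinearMap.smul_apply]
        rw [smul_comm]

/-- The joint evaluation map `(ev_{m_1}, …, ev_{m_n}) : 𝔤 ⊗ A → 𝔤^{⊕ n}`. -/
def jointEvalHom [Algebra.FiniteType ℂ A] {n : ℕ} (m : Fin n → MaximalSpectrum A) :
    Hom (MapSuperalgebra L A) (Fin n → L) where
  toLinearMap := LinearMap.pi fun k => (evalHom L (m k)).toLinearMap
  map_mem z t ht := Submodule.mem_pi.mpr fun k _ => (evalHom L (m k)).map_mem z t ht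
  map_bracket s t := by
    ext k
    exact (evalHom L (m k)).map_bracket s t

end MapSuperalgebra

end MapSuperalgebra

/-! ### Modules over Lie superalgebras -/

/-- A (ℤ/2-graded) module over a Lie superalgebra. -/
structure LieSuperModule (L : Type u) [AddCommGroup L] [Module ℂ L] [LieSuperalgebra L] where
  carrier : Type v
  [addCommGroup : AddCommGroup carrier]
  [module : Module ℂ carrier]
  [superSpace : SuperSpace carrier]
  act : L →ₗ[ℂ] carrier →ₗ[ℂ] carrier
  act_mem : ∀ i j, ∀ x ∈ grade (V := L) i, ∀ v ∈ grade (V := carrier) j,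
    act x v ∈ grade (V := carrier) (i + j)
  act_bracket : ∀ i j, ∀ x ∈ grade (V := L) i, ∀ y ∈ grade (V := L) j, ∀ v,
    act (bracket x y) v = act x (act y v) - koszulSign i j • act y (act x v)

namespace LieSuperModule

attribute [instance] LieSuperModule.addCommGroup LieSuperModule.module LieSuperModule.superSpace

variable {L : Type u} [AddCommGroup L] [Module ℂ L] [LieSuperalgebra L]

/-- A module is trivial if `L · M = 0`. -/
def IsTrivial (M : LieSuperModule.{u, v} L) : Prop := ∀ x v, M.act x v = 0

/-- A module is irreducible if it is nonzero and has no graded submodules other than `0` and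
itself. -/
def IsIrreducible (M : LieSuperModule.{u, v} L) : Prop :=
  Nontrivial M.carrier ∧ ∀ S : Submodule ℂ M.carrier, IsGraded S →
    (∀ x, ∀ v ∈ S, M.act x v ∈ S) → S = ⊥ ∨ S = ⊤

/-- `N` is isomorphic, by an even isomorphism of modules, to the submodule `S` of `M`. -/
def IsoToSubmodule (N : LieSuperModule.{u, w} L) (M : LieSuperModule.{u, v} L)
    (S : Submodule ℂ M.carrier) : Prop :=
  ∃ f : N.carrier →ₗ[ℂ] M.carrier, Function.Injective f ∧ LinearMap.range f = S ∧
    (∀ i, ∀ v ∈ grade (V := N.carrier) i, f v ∈ grade (V := M.carrier) i) ∧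
    ∀ x v, f (N.act x v) = M.act x (f v)

/-- Isomorphism of modules. -/
def Iso (N : LieSuperModule.{u, w} L) (M : LieSuperModule.{u, v} L) : Prop :=
  IsoToSubmodule N M ⊤

/-- `Hom_L(M, N)_z`: the linear maps `f` of degree `z` with `f(x v) = (-1)^(z |x|) x f(v)`. -/
def homs (M : LieSuperModule.{u, v} L) (N : LieSuperModule.{u, w} L) (z : ZMod 2) :
    Submodule ℂ (M.carrier →ₗ[ℂ] N.carrier) where
  carrier := {f | (∀ i, ∀ v ∈ grade (V := M.carrier) i, f v ∈ grade (V := N.carrier) (z + i)) ∧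
    ∀ i, ∀ x ∈ grade (V := L) i, ∀ v, f (M.act x v) = koszulSign z i • N.act x (f v)}
  zero_mem' := ⟨fun _ _ _ => zero_mem _, fun _ _ _ _ => by simp⟩
  add_mem' {f g} hf hg := ⟨fun i v hv => add_mem (hf.1 i v hv) (hg.1 i v hv), fun i x hx v => by
    simp [hf.2 i x hx v, hg.2 i x hx v]⟩
  smul_mem' c f hf := ⟨fun i v hv => Submodule.smul_mem _ c (hf.1 i v hv), fun i x hx v => by
    simp [hf.2 i x hx v, smul_comm c]⟩

/-- The adjoint module. -/
def adjoint (L : Type u) [AddCommGroup L] [Module ℂ L] [LieSuperalgebra L] :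
    LieSuperModule.{u, u} L where
  carrier := L
  act := bracket
  act_mem := bracket_mem
  act_bracket i j x hx y hy z := by
    rw [bracket_jacobi i j x hx y hy z, add_sub_cancel_right]

/-- The pull-back of a module along a homomorphism of Lie superalgebras. -/
def pullback {L' : Type w} [AddCommGroup L'] [Module ℂ L'] [LieSuperalgebra L']
    (M : LieSuperModule.{u, v} L) (φ : Hom L' L) : LieSuperModule.{w, v} L' where
  carrier := M.carrier
  act := M.act.comp φ.toLinearMap
  act_mem i j x hx v hv := M.act_mem i j _ (φ.map_mem i x hx) v hv
  act_bracket i j x hx y hy v := by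
    simp only [LinearMap.comp_apply, φ.map_bracket]
    exact M.act_bracket i j _ (φ.map_mem i x hx) _ (φ.map_mem j y hy) v

/-! #### Tensor products and irreducible products -/

/-- The action on the tensor product: `x (v ⊗ w) = x v ⊗ w + (-1)^(|x| |v|) v ⊗ x w`. -/
def tensorAct (M : LieSuperModule.{u, v} L) (N : LieSuperModule.{u, w} L) :
    L →ₗ[ℂ] (M.carrier ⊗[ℂ] N.carrier) →ₗ[ℂ] (M.carrier ⊗[ℂ] N.carrier) :=
  (LinearMap.rTensorHom N.carrier).comp M.act +
    (TensorProduct.mapBilinear (RingHom.id ℂ) M.carrier N.carrier M.carrier N.carrier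
      LinearMap.id).comp (N.act.comp (proj L 0)) +
    (TensorProduct.mapBilinear (RingHom.id ℂ) M.carrier N.carrier M.carrier N.carrier
      (parity M.carrier)).comp (N.act.comp (proj L 1))

theorem tensorAct_tmul (M : LieSuperModule.{u, v} L) (N : LieSuperModule.{u, w} L) {i j : ZMod 2}
    {x : L} (hx : x ∈ grade (V := L) i) {v : M.carrier} (hv : v ∈ grade (V := M.carrier) j)
    (w : N.carrier) :
    tensorAct M N x (v ⊗ₜ w) = M.act x v ⊗ₜ w + koszulSign i j • (v ⊗ₜ[ℂ] N.act x w) := by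
  rcases zmod_two_cases i with rfl | rfl
  · simp [tensorAct, proj_of_mem hx, proj_of_mem_ne (i := 1) (by decide) hx]
  · rcases zmod_two_cases j with rfl | rfl <;>
    simp [tensorAct, proj_of_mem hx, proj_of_mem_ne (i := 0) (by decide) hx, parity_of_mem hv,
      TensorProduct.neg_tmul]

/-- The tensor product of two modules. -/
def tensor (M : LieSuperModule.{u, v} L) (N : LieSuperModule.{u, w} L) :
    LieSuperModule.{u, max v w} L where
  carrier := M.carrier ⊗[ℂ] N.carrier
  act := tensorAct M N
  act_mem i k x hx t ht := by
    have : tensorGrade M.carrier N.carrier k ≤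
        (tensorGrade M.carrier N.carrier (i + k)).comap (tensorAct M N x) := by
      refine tensorGrade_le fun j l hjl v hv w hw => ?_
      subst hjl
      rw [Submodule.mem_comap, tensorAct_tmul M N hx hv]
      refine add_mem ?_ (Submodule.smul_mem _ _ ?_)
      · rw [← add_assoc]
        exact tmul_mem_tensorGrade (M.act_mem i j x hx v hv) hw
      · rw [add_left_comm]
        exact tmul_mem_tensorGrade hv (N.act_mem i l x hx w hw)
    exact this ht
  act_bracket i j x hx y hy t := by
    induction t with
    | zero => simp
    | add s t hs ht =>
      simp only [map_add, hs, ht, smul_add]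
      abel
    | tmul v w =>
      induction v using homogeneous_induction with
      | hadd a b ha hb =>
        simp only [TensorProduct.add_tmul, map_add, ha, hb, smul_add]
        abel
      | hhom k v hv =>
        rw [tensorAct_tmul M N (bracket_mem i j x hx y hy) hv, tensorAct_tmul M N hx hv,
          tensorAct_tmul M N hy hv]
        simp only [map_add, map_smul]
        rw [tensorAct_tmul M N hx hv, tensorAct_tmul M N hy hv,
          tensorAct_tmul M N hx (M.act_mem j k y hy v hv),
          tensorAct_tmul M N hy (M.act_mem i k x hx v hv),
          M.act_bracket i j x hx y hy, N.act_bracket i j x hx y hy]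
        rcases zmod_two_cases i with rfl | rfl <;> rcases zmod_two_cases j with rfl | rfl <;>
          rcases zmod_two_cases k with rfl | rfl <;>
          simp [zmod_one_add_one, TensorProduct.sub_tmul, TensorProduct.tmul_sub,
            TensorProduct.add_tmul, TensorProduct.tmul_add] <;> abel

/-- For odd maps `φ₁`, `φ₂`, the map `v ⊗ w ↦ (φ₁ ⊗ φ₂)(v ⊗ w) = (-1)^|v| φ₁ v ⊗ φ₂ w`. -/
def oddTensor (M : LieSuperModule.{u, v} L) (N : LieSuperModule.{u, w} L)
    (φ₁ : M.carrier →ₗ[ℂ] M.carrier) (φ₂ : N.carrier →ₗ[ℂ] N.carrier) :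
    (M.carrier ⊗[ℂ] N.carrier) →ₗ[ℂ] (M.carrier ⊗[ℂ] N.carrier) :=
  TensorProduct.map (φ₁.comp (parity M.carrier)) φ₂

/-- `P` is isomorphic to the irreducible product of `M` and `N`: this is `M ⊗ N` if that is
irreducible, and otherwise the submodule of fixed points of `√-1 φ₁ ⊗ φ₂`, where
`φ₁ ∈ End(M)_1`, `φ₂ ∈ End(N)_1` satisfy `φ₁² = φ₂² = -1`. -/
def IsIrreducibleProduct (M : LieSuperModule.{u, v} L) (N : LieSuperModule.{u, w} L)
    (P : LieSuperModule L) : Prop :=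
  ((M.tensor N).IsIrreducible ∧ P.Iso (M.tensor N)) ∨
  (¬ (M.tensor N).IsIrreducible ∧
    ∃ φ₁ ∈ homs M M 1, ∃ φ₂ ∈ homs N N 1,
      φ₁.comp φ₁ = -LinearMap.id ∧ φ₂.comp φ₂ = -LinearMap.id ∧
      P.IsoToSubmodule (M.tensor N)
        (LinearMap.eqLocus (Complex.I • oddTensor M N φ₁ φ₂) LinearMap.id))

/-- For `n ≥ 1` and `𝔤`-modules `M_1, …, M_n`, the `𝔤^{⊕ n}`-module `P` is isomorphic to the
irreducible product of `M_1, …, M_n`, formed one factor at a time from the left, where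
the `k`-th summand of `𝔤^{⊕ n}` acts on `M_k`. -/
def IsIteratedProduct : (n : ℕ) → (Fin n → LieSuperModule.{u, v} L) →
    LieSuperModule.{u, v} (Fin n → L) → Prop
  | 0, _, _ => False
  | 1, M, P => P.Iso ((M 0).pullback (projHom L 0))
  | n + 2, M, P => ∃ K : LieSuperModule.{u, v} (Fin (n + 1) → L),
      IsIteratedProduct (n + 1) (fun k => M k.castSucc) K ∧
      IsIrreducibleProduct (K.pullback (initHom L (n + 1)))
        ((M (Fin.last (n + 1))).pullback (projHom L (Fin.last (n + 1)))) P

/-! #### First cohomology -/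

/-- 1-cocycles of degree `z`: linear maps `f : L → M` of degree `z` with
`f([x, y]) = (-1)^(z |x|) x f(y) - (-1)^(|y| (|x| + z)) y f(x)`. -/
def cocycles (M : LieSuperModule.{u, v} L) (z : ZMod 2) : Submodule ℂ (L →ₗ[ℂ] M.carrier) where
  carrier := {f | (∀ i, ∀ x ∈ grade (V := L) i, f x ∈ grade (V := M.carrier) (z + i)) ∧
    ∀ i j, ∀ x ∈ grade (V := L) i, ∀ y ∈ grade (V := L) j,
      f (bracket x y) = koszulSign z i • M.act x (f y) - koszulSign j (i + z) • M.act y (f x)}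
  zero_mem' := ⟨fun _ _ _ => zero_mem _, fun _ _ _ _ _ _ => by simp⟩
  add_mem' {f g} hf hg := ⟨fun i x hx => add_mem (hf.1 i x hx) (hg.1 i x hx),
    fun i j x hx y hy => by
      simp only [LinearMap.add_apply, hf.2 i j x hx y hy, hg.2 i j x hx y hy, map_add, smul_add]
      abel⟩
  smul_mem' c f hf := ⟨fun i x hx => Submodule.smul_mem _ c (hf.1 i x hx),
    fun i j x hx y hy => by
      simp only [LinearMap.smul_apply, hf.2 i j x hx y hy, map_smul, smul_sub]
      rw [smul_comm c, smul_comm c]⟩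

/-- 1-coboundaries of degree `z`: the maps `x ↦ (-1)^(z |x|) x v` for `v ∈ M_z`. -/
def coboundaries (M : LieSuperModule.{u, v} L) (z : ZMod 2) :
    Submodule ℂ (L →ₗ[ℂ] M.carrier) where
  carrier := {f | ∃ v ∈ grade (V := M.carrier) z,
    ∀ i, ∀ x ∈ grade (V := L) i, f x = koszulSign z i • M.act x v}
  zero_mem' := ⟨0, zero_mem _, fun _ _ _ => by simp⟩
  add_mem' := by
    rintro f g ⟨v, hv, hf⟩ ⟨w, hw, hg⟩
    exact ⟨v + w, add_mem hv hw, fun i x hx => by simp [hf i x hx, hg i x hx]⟩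
  smul_mem' := by
    rintro c f ⟨v, hv, hf⟩
    exact ⟨c • v, Submodule.smul_mem _ c hv, fun i x hx => by simp [hf i x hx, smul_comm c]⟩

theorem coboundaries_le_cocycles (M : LieSuperModule.{u, v} L) (z : ZMod 2) :
    M.coboundaries z ≤ M.cocycles z := by
  rintro f ⟨v, hv, hf⟩
  refine ⟨fun i x hx => ?_, fun i j x hx y hy => ?_⟩
  · rw [hf i x hx, add_comm]
    exact Submodule.smul_mem _ _ (M.act_mem i z x hx v hv)
  · rw [hf _ _ (bracket_mem i j x hx y hy), hf i x hx, hf j y hy, M.act_bracket i j x hx y hy]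
    rcases zmod_two_cases i with rfl | rfl <;> rcases zmod_two_cases j with rfl | rfl <;>
      rcases zmod_two_cases z with rfl | rfl <;> simp [zmod_one_add_one] <;> abel

/-- The degree `z` component `H¹(L, M)_z` of the first cohomology: 1-cocycles of degree `z`
modulo 1-coboundaries of degree `z`. -/
abbrev H1 (M : LieSuperModule.{u, v} L) (z : ZMod 2) : Type _ :=
  M.cocycles z ⧸ (M.coboundaries z).submoduleOf (M.cocycles z)

end LieSuperModule

end

-- Case of one point. `V` is a `𝔤`-module `N` on which `x ⊗ a` acts as `χ(a) x`, with `χ` the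
-- character of the maximal ideal. A cocycle `f` splits into slices `f_a : x ↦ f(x ⊗ a)`, and the
-- cocycle identity for `[x ⊗ a, y ⊗ b]` says three things: `f_1` is a cocycle of `𝔤`; `f_a` is a
-- homomorphism from the adjoint module when `χ(a) = 0`; and `f_a` vanishes on `[𝔤, 𝔤] = 𝔤` when `a
-- ∈ m²`. So `f` is determined by `f_1` and by its slices at lifts `t_j` of a basis of `m / m²`.
-- Conversely, `χ(a) g(x)` (`g` a cocycle of `𝔤`) and `D_j(a) h(x)` (`h` a homomorphism, `D_j` the
-- dual point derivations) are cocycles with arbitrary prescribed data. Coboundaries only affect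
-- `f_1`. This is `EvalIso.nonempty_H1_equiv`.
--
-- Case of several points. Let `J` be one of the maximal ideals and `K` the intersection of the
-- others, so `J + K = A` and `𝔤 ⊗ (J ∩ K)` acts by zero. Every summand of `𝔤^{⊕ ℓ}` acts
-- nontrivially on the irreducible product (`IsIteratedProduct.exists_act_single_ne_zero`), so by
-- irreducibility neither `𝔤 ⊗ J` nor `𝔤 ⊗ K` kills a nonzero vector. A cocycle then vanishes on `𝔤
-- ⊗ (J ∩ K)` (`derivation_mk_eq_zero`), and the two ideals supercommute as far as the action and
-- the cocycle can see.
--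
-- It remains to see that such a derivation `F` is inner (`IsDerivation.exists_eq_inner`). The
-- operators generated by the second ideal form a semisimple algebra, because its radical would
-- produce a proper graded submodule. Hence `1 = ∑ a_k y_k` with `a_k` in that algebra and `y_k` in
-- the second ideal, and the identity `± y F(x) = x F(y)` gives `F(x) = x v` on the first ideal for
-- `v = ∑ a_k F(y_k)`. After subtracting the inner derivation of `v`, the values on the second ideal
-- are killed by the first, so they vanish.

universe v'

noncomputable section

open SuperSpace LieSuperalgebra

/-! ### The parity involution, graded subspaces and conjugation by parity. -/

namespace SuperSpace

variable {V : Type*} [AddCommGroup V] [Module ℂ V] [SuperSpace V]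

theorem parity_parity (v : V) : parity V (parity V v) = v := by
  induction v using homogeneous_induction with
  | hadd a b ha hb => rw [map_add, map_add, ha, hb]
  | hhom i a ha =>
    rw [parity_of_mem ha, map_smul, parity_of_mem ha, smul_smul]
    rcases zmod_two_cases i with rfl | rfl <;> simp

/-- The even projection is `(1 + parity) / 2`, so stability under one involution replaces stability
under two projections. -/
theorem isGraded_of_parity {S : Submodule ℂ V} (h : ∀ v ∈ S, parity V v ∈ S) : IsGraded S := by
  intro i v hv
  have h0 : proj V 0 v = (2⁻¹ : ℂ) • (v + parity V v) := by
    conv_rhs => rw [← proj_add_proj v]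
    rw [map_add, parity_of_mem (proj_mem 0 v), parity_of_mem (proj_mem 1 v)]
    simp only [koszulSign_zero_left, koszulSign_one_one]
    module
  have h1 : proj V 1 v = v - proj V 0 v := by
    rw [eq_sub_iff_add_eq, add_comm, proj_add_proj]
  have h0S : proj V 0 v ∈ S := by
    rw [h0]
    exact Submodule.smul_mem _ _ (add_mem hv (h v hv))
  rcases zmod_two_cases i with rfl | rfl
  · exact h0S
  · rw [h1]
    exact sub_mem hv h0S

variable (V) in
/-- Conjugation by the `i`-th power of the parity involution. -/
def twist (i : ZMod 2) : Module.End ℂ V →ₐ[ℂ] Module.End ℂ V :=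
  if i = 0 then AlgHom.id ℂ _ else
    (LinearEquiv.conjAlgEquiv ℂ (LinearEquiv.ofInvolutive (parity V) parity_parity)).toAlgHom

theorem twist_zero (r : Module.End ℂ V) : twist V 0 r = r := by
  simp [twist]

theorem twist_one_apply (r : Module.End ℂ V) (v : V) :
    twist V 1 r v = parity V (r (parity V v)) := by
  simp only [twist, one_ne_zero, if_false]
  rfl

theorem twist_one_parity (r : Module.End ℂ V) (v : V) :
    parity V (r v) = twist V 1 r (parity V v) := by
  rw [twist_one_apply, parity_parity]

theorem twist_one_twist_one (r : Module.End ℂ V) : twist V 1 (twist V 1 r) = r := by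
  ext v
  simp only [twist_one_apply, parity_parity]

end SuperSpace

/-! ### Ideals acting on irreducible modules, and the operator algebras they generate. -/

namespace LieSuperModule

variable {L : Type u} [AddCommGroup L] [Module ℂ L] [LieSuperalgebra L]

/-- This expresses the Koszul sign through an algebra automorphism, so that the sign rule extends to
products and sums of operators that need not be homogeneous. -/
theorem twist_act (M : LieSuperModule.{u, v} L) {i j : ZMod 2} {y : L}
    (hy : y ∈ grade (V := L) j) : twist M.carrier i (M.act y) = koszulSign i j • M.act y := by
  rcases zmod_two_cases i with rfl | rfl
  · simp [twist_zero]
  · ext v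
    rw [twist_one_apply]
    induction v using homogeneous_induction with
    | hadd a b ha hb => simp only [map_add, ha, hb]
    | hhom k a ha =>
      rw [parity_of_mem ha, map_smul, map_smul, parity_of_mem (M.act_mem j k y hy a ha),
        smul_smul, LinearMap.smul_apply]
      rcases zmod_two_cases j with rfl | rfl <;> rcases zmod_two_cases k with rfl | rfl <;>
        simp [zmod_one_add_one]

theorem parity_act (M : LieSuperModule.{u, v} L) (x : L) (v : M.carrier) :
    parity M.carrier (M.act x v) = M.act (parity L x) (parity M.carrier v) := by
  induction x using homogeneous_induction with
  | hadd a b ha hb => simp only [map_add, LinearMap.add_apply, ha, hb]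
  | hhom j x hx =>
    rw [twist_one_parity, M.twist_act hx, parity_of_mem hx, map_smul]
    rcases zmod_two_cases j with rfl | rfl <;> simp

/-- The identity `F([x, y]) = x F(y) - (-1)^(|x| |y|) y F(x)`. -/
def IsDerivation (M : LieSuperModule.{u, v} L) (F : L →ₗ[ℂ] M.carrier) : Prop :=
  ∀ i j, ∀ x ∈ grade (V := L) i, ∀ y ∈ grade (V := L) j,
    F (bracket x y) = M.act x (F y) - koszulSign i j • M.act y (F x)

/-- `x ↦ x v`. -/
def inner (M : LieSuperModule.{u, v} L) (v : M.carrier) : L →ₗ[ℂ] M.carrier :=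
  M.act.flip v

theorem isDerivation_inner (M : LieSuperModule.{u, v} L) (v : M.carrier) :
    M.IsDerivation (M.inner v) := fun i j x hx y hy => M.act_bracket i j x hx y hy v

theorem IsDerivation.sub {M : LieSuperModule.{u, v} L} {F G : L →ₗ[ℂ] M.carrier}
    (hF : M.IsDerivation F) (hG : M.IsDerivation G) : M.IsDerivation (F - G) := by
  intro i j x hx y hy
  simp only [LinearMap.sub_apply, hF i j x hx y hy, hG i j x hx y hy, map_sub, smul_sub]
  abel

/-- The vectors killed by a subspace of the Lie superalgebra. -/
def killed (M : LieSuperModule.{u, v} L) (I : Submodule ℂ L) : Submodule ℂ M.carrier :=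
  ⨅ x ∈ I, LinearMap.ker (M.act x)

theorem mem_killed {M : LieSuperModule.{u, v} L} {I : Submodule ℂ L} {v : M.carrier} :
    v ∈ M.killed I ↔ ∀ x ∈ I, M.act x v = 0 := by
  simp [killed, Submodule.mem_iInf]

theorem parity_mem_of_isGraded {S : Submodule ℂ L} (hS : IsGraded S) {x : L} (hx : x ∈ S) :
    parity L x ∈ S :=
  sub_mem (hS 0 x hx) (hS 1 x hx)

/-- An ideal acting nontrivially on an irreducible module kills no nonzero vector. -/
theorem killed_eq_bot {M : LieSuperModule.{u, v} L} (hM : M.IsIrreducible) {I : Submodule ℂ L}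
    (hI : IsGraded I) (hIL : ∀ x, ∀ y ∈ I, bracket x y ∈ I) {x₀ : L} (hx₀ : x₀ ∈ I)
    (hne : M.act x₀ ≠ 0) : M.killed I = ⊥ := by
  refine (hM.2 (M.killed I) (isGraded_of_parity fun v hv => ?_) fun x v hv => ?_).resolve_right
    fun h => hne ?_
  · rw [mem_killed] at hv ⊢
    intro x hx
    have := M.parity_act (parity L x) v
    rw [parity_parity, hv _ (parity_mem_of_isGraded hI hx), map_zero] at this
    exact this.symm
  · rw [mem_killed] at hv ⊢
    intro y hy
    induction x using homogeneous_induction with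
    | hadd a b ha hb => simp only [map_add, LinearMap.add_apply, ha, hb, add_zero]
    | hhom i x hx =>
      have key : ∀ j, ∀ y ∈ I, y ∈ grade (V := L) j → M.act y (M.act x v) = 0 := by
        intro j y hy hyj
        -- Both `[x, y]` and `y` lie in `I` and kill `v`, so only the term `y (x v)` survives.
        have h := M.act_bracket i j x hx y hyj v
        rw [hv _ (hIL x y hy), hv y hy, map_zero, zero_sub] at h
        have h' := neg_eq_zero.mp h.symm
        rcases zmod_two_cases i with rfl | rfl <;> rcases zmod_two_cases j with rfl | rfl <;>
          simpa using h'
      rw [← proj_add_proj y, map_add, LinearMap.add_apply, key 0 _ (hI 0 y hy) (proj_mem 0 y),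
        key 1 _ (hI 1 y hy) (proj_mem 1 y), add_zero]
  · ext v
    exact mem_killed.mp (h ▸ Submodule.mem_top : v ∈ M.killed I) x₀ hx₀

/-- The associative algebra of operators generated by a subspace of the Lie superalgebra. -/
def enveloping (M : LieSuperModule.{u, v} L) (I : Submodule ℂ L) :
    Subalgebra ℂ (Module.End ℂ M.carrier) :=
  Algebra.adjoin ℂ (M.act '' I)

theorem act_mem_enveloping (M : LieSuperModule.{u, v} L) {I : Submodule ℂ L} {y : L}
    (hy : y ∈ I) : M.act y ∈ M.enveloping I :=
  Algebra.subset_adjoin ⟨y, hy, rfl⟩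

theorem twist_mem_enveloping (M : LieSuperModule.{u, v} L) {I : Submodule ℂ L} (hI : IsGraded I)
    (r : Module.End ℂ M.carrier) (hr : r ∈ M.enveloping I) :
    twist M.carrier 1 r ∈ M.enveloping I := by
  have : M.enveloping I ≤ (M.enveloping I).comap (twist M.carrier 1) := by
    refine Algebra.adjoin_le ?_
    rintro _ ⟨y, hy, rfl⟩
    have : twist M.carrier 1 (M.act y) = M.act (parity L y) := by
      ext v
      rw [twist_one_apply, M.parity_act, parity_parity]
    change twist M.carrier 1 (M.act y) ∈ M.enveloping I
    rw [this]
    exact M.act_mem_enveloping (parity_mem_of_isGraded hI hy)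
  exact this hr

/-- Operators of commuting ideals supercommute. -/
theorem act_mul_enveloping (M : LieSuperModule.{u, v} L) {I J : Submodule ℂ L}
    (hJ : IsGraded J) (hIJ : ∀ x ∈ I, ∀ y ∈ J, M.act (bracket x y) = 0) {i : ZMod 2} {x : L}
    (hx : x ∈ I) (hxi : x ∈ grade (V := L) i) {r : Module.End ℂ M.carrier}
    (hr : r ∈ M.enveloping J) : M.act x * r = twist M.carrier i r * M.act x := by
  induction hr using Algebra.adjoin_induction with
  | mem r hr =>
    obtain ⟨y, hy, rfl⟩ := hr
    have key : ∀ j, ∀ y ∈ J, y ∈ grade (V := L) j →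
        M.act x * M.act y = twist M.carrier i (M.act y) * M.act x := by
      intro j y hy hyj
      ext v
      rw [M.twist_act hyj]
      have h := M.act_bracket i j x hxi y hyj v
      rw [hIJ x hx y hy, LinearMap.zero_apply] at h
      exact sub_eq_zero.mp h.symm
    rw [← proj_add_proj y, map_add, map_add, mul_add, add_mul,
      key 0 _ (hJ 0 y hy) (proj_mem 0 y), key 1 _ (hJ 1 y hy) (proj_mem 1 y)]
  | algebraMap c => rw [AlgHom.commutes, Algebra.commutes]
  | add r s _ _ hr hs => rw [mul_add, map_add, add_mul, hr, hs]
  | mul r s _ _ hr hs => rw [← mul_assoc, hr, map_mul, mul_assoc, hs, mul_assoc]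

/-! ### Semisimplicity of the operator algebra of an ideal, and inner derivations. -/

section Semisimple

variable {M : LieSuperModule.{u, v} L} [FiniteDimensional ℂ M.carrier] {I J : Submodule ℂ L}

/-- An automorphism of the ring of operators. -/
def twistEnveloping (M : LieSuperModule.{u, v} L) {J : Submodule ℂ L} (hJ : IsGraded J) :
    M.enveloping J →+* M.enveloping J :=
  (((twist M.carrier 1).comp (M.enveloping J).val).codRestrict (M.enveloping J)
    fun r => M.twist_mem_enveloping hJ r r.2).toRingHom

/-- Let `R` be the algebra and `N = rad(R) · M`. It is stable under `J` by construction, under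
parity because conjugation by parity is an automorphism of `R` and preserves the radical, and under
`I` because `x r = twist(r) x`. By Nakayama `N` is proper, so irreducibility gives `N = 0`; as `R`
acts faithfully, its radical is zero. -/
theorem jacobson_enveloping (hM : M.IsIrreducible) (hI : IsGraded I) (hJ : IsGraded J)
    (hIJ : ∀ x ∈ I, ∀ y ∈ J, M.act (bracket x y) = 0) (htop : I ⊔ J = ⊤) :
    Ring.jacobson (M.enveloping J) = ⊥ := by
  have := hM.1
  have hfin : Module.Finite (M.enveloping J) M.carrier := Module.Finite.of_restrictScalars_finite ℂ _ _
  have hsurj : RingHomSurjective (twistEnveloping M hJ) :=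
    ⟨fun r => ⟨twistEnveloping M hJ r, Subtype.ext (twist_one_twist_one r.1)⟩⟩
  have htw : ∀ n ∈ Ring.jacobson (M.enveloping J),
      twistEnveloping M hJ n ∈ Ring.jacobson (M.enveloping J) :=
    fun n hn => Ring.le_comap_jacobson (twistEnveloping M hJ) hn
  set N : Submodule (M.enveloping J) M.carrier := Ring.jacobson (M.enveloping J) • ⊤ with hN
  have hsm : ∀ (n : M.enveloping J) (v : M.carrier), n • v = n.1 v := fun _ _ => rfl
  have hmem : ∀ n ∈ Ring.jacobson (M.enveloping J), ∀ v, n.1 v ∈ N := fun n hn v =>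
    Submodule.smul_mem_smul hn (Submodule.mem_top : v ∈ ⊤)
  have hbot := (hM.2 (N.restrictScalars ℂ) (isGraded_of_parity fun v hv => ?_) ?_).resolve_right ?_
  · rw [eq_bot_iff]
    intro n hn
    rw [Submodule.mem_bot]
    ext v
    have := hmem n hn v
    rw [← Submodule.restrictScalars_mem ℂ, hbot] at this
    simpa using this
  · rw [Submodule.restrictScalars_mem] at hv ⊢
    refine Submodule.smul_induction_on hv (fun n hn v _ => ?_) fun a b ha hb => ?_
    · rw [hsm, twist_one_parity]
      exact hmem _ (htw n hn) _
    · rw [map_add]; exact add_mem ha hb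
  · intro x v hv
    rw [Submodule.restrictScalars_mem] at hv ⊢
    have hx : x ∈ I ⊔ J := htop ▸ Submodule.mem_top
    obtain ⟨y, hy, z, hz, rfl⟩ := Submodule.mem_sup.mp hx
    rw [map_add, LinearMap.add_apply]
    refine add_mem ?_ (N.smul_mem ⟨M.act z, M.act_mem_enveloping hz⟩ hv)
    refine Submodule.smul_induction_on hv (fun n hn v _ => ?_) fun a b ha hb => ?_
    · have h0 := congrArg (· v) (M.act_mul_enveloping hJ hIJ (hI 0 y hy) (proj_mem 0 y) n.2)
      have h1 := congrArg (· v) (M.act_mul_enveloping hJ hIJ (hI 1 y hy) (proj_mem 1 y) n.2)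
      simp only [Module.End.mul_apply, twist_zero] at h0 h1
      rw [hsm, ← proj_add_proj y, map_add, LinearMap.add_apply, h0, h1]
      exact add_mem (hmem n hn _) (hmem _ (htw n hn) _)
    · rw [map_add]; exact add_mem ha hb
  · intro h
    have hlt : N < ⊤ := Submodule.jacobson_smul_lt_top ⊤
    refine hlt.ne (eq_top_iff.mpr fun v _ => ?_)
    rw [← Submodule.restrictScalars_mem ℂ, h]
    exact Submodule.mem_top

/-- The left ideal of operators generated by an ideal without invariants contains the identity. -/
theorem one_mem_span_act (hM : M.IsIrreducible) (hI : IsGraded I) (hJ : IsGraded J)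
    (hIJ : ∀ x ∈ I, ∀ y ∈ J, M.act (bracket x y) = 0) (htop : I ⊔ J = ⊤)
    (hinv : M.killed J = ⊥) :
    (1 : M.enveloping J) ∈ Ideal.span {r : M.enveloping J | ∃ y ∈ J, r.1 = M.act y} := by
  have hart : IsArtinianRing (M.enveloping J) := IsArtinianRing.of_finite ℂ _
  have hss : IsSemisimpleRing (M.enveloping J) :=
    IsArtinianRing.isSemisimpleRing_iff_jacobson.mpr (jacobson_enveloping hM hI hJ hIJ htop)
  set K : Ideal (M.enveloping J) := Ideal.span {r : M.enveloping J | ∃ y ∈ J, r.1 = M.act y}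
  obtain ⟨K', hK'⟩ := exists_isCompl K
  obtain ⟨e, he, e', he', hee⟩ := Submodule.mem_sup.mp
    (hK'.sup_eq_top ▸ Submodule.mem_top : (1 : M.enveloping J) ∈ K ⊔ K')
  -- For `y ∈ J`, the operator `y e' = y - y e` lies in `K` and, as `K'` is a left ideal, also in
  -- `K'`. So `y e' = 0`, and the image of `e'` consists of vectors killed by `J`.
  have hz : e' = 0 := by
    ext v
    have : e'.1 v ∈ M.killed J := by
      rw [mem_killed]
      intro y hy
      set r : M.enveloping J := ⟨M.act y, M.act_mem_enveloping hy⟩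
      have hr : r ∈ K := Ideal.subset_span ⟨y, hy, rfl⟩
      have h1 : r * e' ∈ K := by
        have : r * e' = r - r * e := by rw [eq_sub_iff_add_eq, ← mul_add, add_comm, hee, mul_one]
        rw [this]
        exact sub_mem hr (K.mul_mem_left r he)
      have h2 := Submodule.disjoint_def.mp hK'.disjoint _ h1 (K'.mul_mem_left r he')
      exact congrArg (fun s : M.enveloping J => s.1 v) h2
    rw [hinv] at this
    simpa using this
  rw [← hee, hz, add_zero]
  exact he

/-- Derivations into an irreducible module on which two supercommuting ideals, which span
the Lie superalgebra, act without invariants, are inner. -/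
theorem IsDerivation.exists_eq_inner {F : L →ₗ[ℂ] M.carrier} (hF : M.IsDerivation F)
    (hM : M.IsIrreducible) (hI : IsGraded I) (hJ : IsGraded J)
    (hIJ : ∀ x ∈ I, ∀ y ∈ J, M.act (bracket x y) = 0)
    (hFIJ : ∀ x ∈ I, ∀ y ∈ J, F (bracket x y) = 0) (htop : I ⊔ J = ⊤)
    (hinvI : M.killed I = ⊥) (hinvJ : M.killed J = ⊥) : ∃ v, F = M.inner v := by
  -- Since `F([x, y]) = 0`, the derivation identity becomes a symmetry between `x` and `y`.
  have hcomm : ∀ i, ∀ x ∈ I, x ∈ grade (V := L) i → ∀ y ∈ J,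
      twist M.carrier i (M.act y) (F x) = M.act x (F y) := by
    intro i x hx hxi y hy
    have key : ∀ j, ∀ y ∈ J, y ∈ grade (V := L) j →
        twist M.carrier i (M.act y) (F x) = M.act x (F y) := by
      intro j y hy hyj
      have h := hF i j x hxi y hyj
      rw [hFIJ x hx y hy] at h
      rw [M.twist_act hyj, LinearMap.smul_apply]
      exact (sub_eq_zero.mp h.symm).symm
    rw [← proj_add_proj y]
    simp only [map_add, LinearMap.add_apply]
    rw [key 0 _ (hJ 0 y hy) (proj_mem 0 y), key 1 _ (hJ 1 y hy) (proj_mem 1 y)]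
  -- For `r = ∑ a_k y_k` the vector is `∑ a_k F(y_k)`, independent of `x`: each `a_k` is moved past
  -- `x` at the price of a twist. The case `r = 1` shows that `F` is inner on `I`.
  have hT : ∀ r ∈ Ideal.span {r : M.enveloping J | ∃ y ∈ J, r.1 = M.act y},
      ∃ v, ∀ i, ∀ x ∈ I, x ∈ grade (V := L) i → twist M.carrier i r.1 (F x) = M.act x v := by
    intro r hr
    induction hr using Submodule.span_induction with
    | mem r hr =>
      obtain ⟨y, hy, hry⟩ := hr
      exact ⟨F y, fun i x hx hxi => by rw [hry, hcomm i x hx hxi y hy]⟩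
    | zero => exact ⟨0, fun i x hx hxi => by simp⟩
    | add r s _ _ hr hs =>
      obtain ⟨v, hv⟩ := hr
      obtain ⟨w, hw⟩ := hs
      refine ⟨v + w, fun i x hx hxi => ?_⟩
      rw [map_add, ← hv i x hx hxi, ← hw i x hx hxi, Subalgebra.coe_add, map_add,
        LinearMap.add_apply]
    | smul a r _ hr =>
      obtain ⟨v, hv⟩ := hr
      refine ⟨a.1 v, fun i x hx hxi => ?_⟩
      have h := congrArg (· v) (M.act_mul_enveloping hJ hIJ hx hxi a.2)
      simp only [Module.End.mul_apply] at h
      rw [h, ← hv i x hx hxi, smul_eq_mul, Subalgebra.coe_mul, map_mul, Module.End.mul_apply]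
  obtain ⟨v, hv⟩ := hT 1 (one_mem_span_act hM hI hJ hIJ htop hinvJ)
  have hG := hF.sub (M.isDerivation_inner v)
  have hGI : ∀ x ∈ I, (F - M.inner v) x = 0 := by
    intro x hx
    have key : ∀ i, (F - M.inner v) (proj L i x) = 0 := by
      intro i
      have h := hv i _ (hI i x hx) (proj_mem i x)
      rw [Subalgebra.coe_one, map_one, Module.End.one_apply] at h
      rw [LinearMap.sub_apply, h]
      exact sub_self _
    rw [← proj_add_proj x, map_add, key, key, add_zero]
  -- With `G = F - inner v`, the identity `0 = G([x, y]) = x G(y) - ± y G(x)` and `G(x) = 0` give `x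
  -- G(y) = 0` for all `x ∈ I`.
  have hGJ : ∀ y ∈ J, (F - M.inner v) y = 0 := by
    intro y hy
    have key : ∀ j, (F - M.inner v) (proj L j y) ∈ M.killed I := by
      intro j
      rw [mem_killed]
      intro x hx
      have key' : ∀ i, M.act (proj L i x) ((F - M.inner v) (proj L j y)) = 0 := by
        intro i
        have h := hG i j _ (proj_mem i x) _ (proj_mem j y)
        rw [hGI _ (hI i x hx), map_zero, smul_zero, sub_zero, LinearMap.sub_apply,
          hFIJ _ (hI i x hx) _ (hJ j y hy)] at h
        rw [← h, zero_sub, neg_eq_zero]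
        change M.act _ v = 0
        rw [hIJ _ (hI i x hx) _ (hJ j y hy), LinearMap.zero_apply]
      rw [← proj_add_proj x, map_add, LinearMap.add_apply, key', key', add_zero]
    simp only [hinvI, Submodule.mem_bot] at key
    rw [← proj_add_proj y, map_add, key, key, add_zero]
  refine ⟨v, sub_eq_zero.mp (LinearMap.ext fun t => ?_)⟩
  obtain ⟨x, hx, y, hy, rfl⟩ := Submodule.mem_sup.mp (htop ▸ Submodule.mem_top : t ∈ I ⊔ J)
  rw [map_add, hGI x hx, hGJ y hy, add_zero, LinearMap.zero_apply]

end Semisimple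

end LieSuperModule

/-! ### Nontriviality of the action of each factor on an irreducible product. -/

theorem TensorProduct.eq_zero_or_eq_zero_of_tmul_eq_zero {V W : Type*} [AddCommGroup V]
    [Module ℂ V] [AddCommGroup W] [Module ℂ W] {v : V} {w : W} (h : v ⊗ₜ[ℂ] w = 0) :
    v = 0 ∨ w = 0 := by
  by_contra! hvw
  refine hvw.2 ((Module.forall_dual_apply_eq_zero_iff ℂ w).mp fun φ => ?_)
  have := congrArg (TensorProduct.rid ℂ V) (congrArg (LinearMap.lTensor V φ) h)
  simpa [hvw.1] using this

namespace LieSuperModule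

section IrreducibleProduct

variable {L : Type u} [AddCommGroup L] [Module ℂ L] [LieSuperalgebra L]

theorem oddTensor_tmul (M : LieSuperModule.{u, v} L) (N : LieSuperModule.{u, w} L)
    (φ₁ : M.carrier →ₗ[ℂ] M.carrier) (φ₂ : N.carrier →ₗ[ℂ] N.carrier) {j : ZMod 2} {v : M.carrier}
    (hv : v ∈ grade (V := M.carrier) j) (w : N.carrier) :
    oddTensor M N φ₁ φ₂ (v ⊗ₜ w) = koszulSign j 1 • (φ₁ v ⊗ₜ φ₂ w) := by
  simp [oddTensor, parity_of_mem hv, TensorProduct.smul_tmul']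

theorem act_eq_zero_of_isoToSubmodule {N : LieSuperModule.{u, w} L} {M : LieSuperModule.{u, v} L}
    {S : Submodule ℂ M.carrier} (h : N.IsoToSubmodule M S) {x : L} (hx : N.act x = 0)
    {s : M.carrier} (hs : s ∈ S) : M.act x s = 0 := by
  obtain ⟨f, -, hfS, -, hf⟩ := h
  rw [← hfS] at hs
  obtain ⟨p, rfl⟩ := hs
  rw [← hf, hx, LinearMap.zero_apply, map_zero]

/-- Up to a correction whose first factor has opposite parity, pure tensors belong to
the irreducible product. -/
theorem IsIrreducibleProduct.exists_tensorAct_eq_zero {M : LieSuperModule.{u, v} L}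
    {N : LieSuperModule.{u, v} L} {P : LieSuperModule.{u, w} L} (h : IsIrreducibleProduct M N P)
    {x : L} (hx : P.act x = 0) {j : ZMod 2} {v : M.carrier} (hv : v ∈ grade (V := M.carrier) j)
    (w : N.carrier) :
    ∃ v' ∈ grade (V := M.carrier) (1 + j), ∃ w',
      tensorAct M N x (v ⊗ₜ w) + tensorAct M N x (v' ⊗ₜ w') = 0 := by
  rcases h with ⟨-, h⟩ | ⟨-, φ₁, h₁, φ₂, -, hφ₁, hφ₂, h⟩
  · refine ⟨0, zero_mem _, 0, ?_⟩
    rw [TensorProduct.zero_tmul, map_zero, add_zero]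
    exact act_eq_zero_of_isoToSubmodule h hx (s := v ⊗ₜ[ℂ] w) Submodule.mem_top
  · have hv' := h₁.1 j v hv
    -- The operator `T = √-1 φ₁ ⊗ φ₂` is an involution, so `u + T u` is fixed by `T`; the witnesses
    -- make `v' ⊗ w'` equal to `T (v ⊗ w)`. Its first factor changes parity because `φ₁` is odd.
    refine ⟨Complex.I • koszulSign j 1 • φ₁ v,
      Submodule.smul_mem _ _ (Submodule.smul_mem _ _ hv'), φ₂ w, ?_⟩
    rw [← map_add]
    have e₁ : φ₁ (φ₁ v) = -v := congrArg (· v) hφ₁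
    have e₂ : φ₂ (φ₂ w) = -w := congrArg (· w) hφ₂
    refine act_eq_zero_of_isoToSubmodule (M := M.tensor N) h hx ?_
    change Complex.I • oddTensor M N φ₁ φ₂ (v ⊗ₜ[ℂ] w + (Complex.I • koszulSign j 1 • φ₁ v) ⊗ₜ φ₂ w) =
      v ⊗ₜ[ℂ] w + (Complex.I • koszulSign j 1 • φ₁ v) ⊗ₜ φ₂ w
    rw [← TensorProduct.smul_tmul', ← TensorProduct.smul_tmul', map_add,
      map_smul, map_smul, oddTensor_tmul M N φ₁ φ₂ hv, oddTensor_tmul M N φ₁ φ₂ hv', e₁, e₂,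
      TensorProduct.neg_tmul, TensorProduct.tmul_neg, neg_neg]
    rcases zmod_two_cases j with rfl | rfl
    · simp only [add_zero, koszulSign_zero_left, koszulSign_one_one, one_smul, smul_add, smul_smul,
        neg_smul, smul_neg, Complex.I_mul_I, neg_neg]
      exact add_comm _ _
    · simp only [zmod_one_add_one, koszulSign_zero_left, koszulSign_one_one, one_smul, smul_add,
        smul_smul, neg_smul, smul_neg, Complex.I_mul_I, neg_neg]
      exact add_comm _ _

/-- In the non-irreducible case pure tensors are not in the product, but `v ⊗ w + v' ⊗ w'` is. As
`v` and `v'` have opposite parities, projecting the first tensor factor onto one degree isolates `x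
v ⊗ w`. -/
theorem IsIrreducibleProduct.act_ne_zero_of_left {M : LieSuperModule.{u, v} L}
    {N : LieSuperModule.{u, v} L} {P : LieSuperModule.{u, w} L} (h : IsIrreducibleProduct M N P)
    [Nontrivial N.carrier] {i : ZMod 2} {x : L} (hxi : x ∈ grade (V := L) i)
    (hM : M.act x ≠ 0) (hN : N.act x = 0) : P.act x ≠ 0 := by
  intro hx
  obtain ⟨w, hw⟩ := exists_ne (0 : N.carrier)
  refine hM (LinearMap.ext fun v => ?_)
  induction v using homogeneous_induction with
  | hadd a b ha hb => rw [map_add, ha, hb, map_add]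
  | hhom j v hv =>
    obtain ⟨v', hv', w', e⟩ := h.exists_tensorAct_eq_zero hx hv w
    rw [tensorAct_tmul M N hxi hv, tensorAct_tmul M N hxi hv', hN] at e
    simp only [LinearMap.zero_apply, TensorProduct.tmul_zero, smul_zero, add_zero] at e
    have e' := congrArg (TensorProduct.map (proj M.carrier (i + j)) LinearMap.id) e
    rw [map_add, TensorProduct.map_tmul, TensorProduct.map_tmul,
      proj_of_mem (M.act_mem i j x hxi v hv), proj_of_mem_ne (by simp) (M.act_mem i _ x hxi v' hv'),
      TensorProduct.zero_tmul, add_zero, map_zero, LinearMap.id_apply] at e'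
    exact (TensorProduct.eq_zero_or_eq_zero_of_tmul_eq_zero e').resolve_right hw

theorem IsIrreducibleProduct.act_ne_zero_of_right {M : LieSuperModule.{u, v} L}
    {N : LieSuperModule.{u, v} L} {P : LieSuperModule.{u, w} L} (h : IsIrreducibleProduct M N P)
    [Nontrivial M.carrier] {i : ZMod 2} {x : L} (hxi : x ∈ grade (V := L) i)
    (hM : M.act x = 0) (hN : N.act x ≠ 0) : P.act x ≠ 0 := by
  intro hx
  obtain ⟨v, hv0⟩ := exists_ne (0 : M.carrier)
  refine hN (LinearMap.ext fun w => ?_)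
  -- The goal becomes `v = 0`, which is additive in `v` and so can be checked on homogeneous
  -- components.
  contrapose! hv0
  induction v using homogeneous_induction with
  | hadd a b ha hb => rw [ha, hb, add_zero]
  | hhom j v hv =>
    obtain ⟨v', hv', w', e⟩ := h.exists_tensorAct_eq_zero hx hv w
    rw [tensorAct_tmul M N hxi hv, tensorAct_tmul M N hxi hv', hM] at e
    simp only [LinearMap.zero_apply, TensorProduct.zero_tmul, zero_add] at e
    have e' := congrArg (TensorProduct.map (proj M.carrier j) LinearMap.id) e
    rw [map_add, map_smul, map_smul, TensorProduct.map_tmul, TensorProduct.map_tmul,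
      proj_of_mem hv, proj_of_mem_ne (by simp) hv',
      TensorProduct.zero_tmul, smul_zero, add_zero, map_zero, LinearMap.id_apply] at e'
    have hs : koszulSign i j ≠ 0 := by unfold koszulSign; split_ifs <;> norm_num
    exact (TensorProduct.eq_zero_or_eq_zero_of_tmul_eq_zero
      ((smul_eq_zero.mp e').resolve_left hs)).resolve_right hv0

end IrreducibleProduct

/-! ### Iterated products: each summand acts nontrivially. -/

section IteratedProduct

variable {L : Type u} [AddCommGroup L] [Module ℂ L] [LieSuperalgebra L]

theorem exists_homogeneous_act_ne_zero {M : LieSuperModule.{u, v} L} (h : ¬ M.IsTrivial) :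
    ∃ i, ∃ x ∈ grade (V := L) i, M.act x ≠ 0 := by
  contrapose! h
  intro x v
  rw [← proj_add_proj x, map_add, h 0 _ (proj_mem 0 x), h 1 _ (proj_mem 1 x)]
  simp

theorem nontrivial_of_act_ne_zero {M : LieSuperModule.{u, v} L} {x : L} (h : M.act x ≠ 0) :
    Nontrivial M.carrier := by
  by_contra hn
  rw [not_nontrivial_iff_subsingleton] at hn
  exact h (LinearMap.ext fun v => Subsingleton.elim _ _)

theorem pullback_act {L' : Type w} [AddCommGroup L'] [Module ℂ L'] [LieSuperalgebra L']
    (M : LieSuperModule.{u, v} L) (φ : Hom L' L) (x : L') :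
    (M.pullback φ).act x = M.act (φ.toLinearMap x) := rfl

theorem single_mem_grade {n : ℕ} (k : Fin n) {i : ZMod 2} {x : L} (hx : x ∈ grade (V := L) i) :
    (Pi.single k x : Fin n → L) ∈ grade (V := Fin n → L) i := by
  refine Submodule.mem_pi.mpr fun j _ => ?_
  by_cases h : j = k
  · subst h; simpa using hx
  · simp [h]

/-- Each summand acts nontrivially on an iterated product of nontrivial modules. -/
theorem IsIteratedProduct.exists_act_single_ne_zero : ∀ {n : ℕ} {W : Fin n → LieSuperModule.{u, v} L}
    {P : LieSuperModule.{u, v} (Fin n → L)}, IsIteratedProduct n W P → (∀ k, ¬ (W k).IsTrivial) →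
    ∀ k, ∃ i, ∃ x ∈ grade (V := L) i, P.act (Pi.single k x) ≠ 0
  | 0, _, _, h, _, _ => h.elim
  | 1, W, P, h, hW, k => by
    obtain ⟨i, x, hxi, hx⟩ := exists_homogeneous_act_ne_zero (hW k)
    refine ⟨i, x, hxi, fun h0 => hx ?_⟩
    obtain rfl : k = 0 := Subsingleton.elim _ _
    ext v
    have := act_eq_zero_of_isoToSubmodule h h0
      (s := (v : ((W 0).pullback (projHom L (0 : Fin 1))).carrier)) Submodule.mem_top
    rw [pullback_act] at this
    have e : (projHom L (0 : Fin 1)).toLinearMap (Pi.single 0 x) = x := by simp [projHom]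
    rwa [e] at this
  | n + 2, W, P, h, hW, k => by
    obtain ⟨K, hK, hP⟩ := h
    have ih := hK.exists_act_single_ne_zero fun k => hW k.castSucc
    obtain ⟨_, x₁, -, hx₁⟩ := ih 0
    have : Nontrivial K.carrier := nontrivial_of_act_ne_zero hx₁
    obtain ⟨i₂, x₂, hx₂i, hx₂⟩ := exists_homogeneous_act_ne_zero (hW (Fin.last (n + 1)))
    have : Nontrivial (W (Fin.last (n + 1))).carrier := nontrivial_of_act_ne_zero hx₂
    induction k using Fin.lastCases with
    | last =>
      have : Nontrivial (K.pullback (initHom L (n + 1))).carrier :=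
        inferInstanceAs (Nontrivial K.carrier)
      refine ⟨i₂, x₂, hx₂i, hP.act_ne_zero_of_right (single_mem_grade _ hx₂i) ?_ ?_⟩
      · have : (initHom L (n + 1)).toLinearMap (Pi.single (Fin.last (n + 1)) x₂) = 0 := by
          ext j
          simp [initHom]
        rw [pullback_act, this, map_zero]
        rfl
      · have : (projHom L (Fin.last (n + 1))).toLinearMap (Pi.single (Fin.last (n + 1)) x₂) = x₂ := by
          simp [projHom]
        rw [pullback_act, this]
        exact hx₂
    | cast k =>
      have : Nontrivial ((W (Fin.last (n + 1))).pullback (projHom L (Fin.last (n + 1)))).carrier :=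
        inferInstanceAs (Nontrivial (W (Fin.last (n + 1))).carrier)
      obtain ⟨i, x, hxi, hx⟩ := ih k
      refine ⟨i, x, hxi, hP.act_ne_zero_of_left (single_mem_grade _ hxi) ?_ ?_⟩
      · have : (initHom L (n + 1)).toLinearMap (Pi.single k.castSucc x) = Pi.single k x := by
          ext j
          by_cases hjk : j = k
          · subst hjk; simp [initHom]
          · simp [initHom, hjk]
        rw [pullback_act, this]
        exact hx
      · have : (projHom L (Fin.last (n + 1))).toLinearMap (Pi.single k.castSucc x) = 0 := by
          simp [projHom]
        rw [pullback_act, this, map_zero]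
        rfl

end IteratedProduct

end LieSuperModule

/-! ### Cocycles of degree `z` as derivations without degree-dependent signs. -/

namespace LieSuperModule

variable {L : Type u} [AddCommGroup L] [Module ℂ L] [LieSuperalgebra L]

/-- The map `x ↦ (-1)^(z |x|) f(x)`. -/
def untwist (M : LieSuperModule.{u, v} L) (z : ZMod 2) (f : L →ₗ[ℂ] M.carrier) :
    L →ₗ[ℂ] M.carrier :=
  if z = 0 then f else f.comp (parity L)

theorem untwist_apply (M : LieSuperModule.{u, v} L) (z : ZMod 2) (f : L →ₗ[ℂ] M.carrier)
    {i : ZMod 2} {x : L} (hx : x ∈ grade (V := L) i) :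
    M.untwist z f x = koszulSign z i • f x := by
  rcases zmod_two_cases z with rfl | rfl
  · simp [untwist]
  · rcases zmod_two_cases i with rfl | rfl <;> simp [untwist, parity_of_mem hx]

theorem isDerivation_untwist {M : LieSuperModule.{u, v} L} {z : ZMod 2} {f : L →ₗ[ℂ] M.carrier}
    (hf : f ∈ M.cocycles z) : M.IsDerivation (M.untwist z f) := by
  intro i j x hx y hy
  rw [M.untwist_apply z f (bracket_mem i j x hx y hy), M.untwist_apply z f hx,
    M.untwist_apply z f hy, hf.2 i j x hx y hy, map_smul, map_smul]
  rcases zmod_two_cases i with rfl | rfl <;> rcases zmod_two_cases j with rfl | rfl <;>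
    rcases zmod_two_cases z with rfl | rfl <;> simp [zmod_one_add_one] <;> abel

/-- The vector `v` need not be homogeneous. Since `f` has degree `z`, comparing components of degree
`z + i` shows that the degree `z` part of `v` already gives `f`. -/
theorem mem_coboundaries_of_untwist_eq_inner {M : LieSuperModule.{u, v} L} {z : ZMod 2}
    {f : L →ₗ[ℂ] M.carrier} (hf : f ∈ M.cocycles z) {v : M.carrier}
    (h : M.untwist z f = M.inner v) : f ∈ M.coboundaries z := by
  refine ⟨proj M.carrier z v, proj_mem z v, fun i x hx => ?_⟩
  have h1 : koszulSign z i • f x = M.act x v := by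
    rw [← M.untwist_apply z f hx, h]; rfl
  have h2 : f x = koszulSign z i • M.act x v := by
    rw [← h1, smul_smul]
    rcases zmod_two_cases i with rfl | rfl <;> rcases zmod_two_cases z with rfl | rfl <;> simp
  have h3 := proj_of_mem (hf.1 i x hx)
  have h4 : M.act x v = M.act x (proj M.carrier z v) + M.act x (proj M.carrier (z + 1) v) := by
    rw [← map_add]
    congr 1
    rcases zmod_two_cases z with rfl | rfl
    · exact (proj_add_proj v).symm
    · rw [zmod_one_add_one, add_comm]; exact (proj_add_proj v).symm
  have h5 : proj M.carrier (z + i) (M.act x (proj M.carrier (z + 1) v)) = 0 :=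
    proj_of_mem_ne (by rw [← add_assoc, add_comm i z]; simp)
      (M.act_mem i (z + 1) x hx _ (proj_mem _ v))
  have h6 : proj M.carrier (z + i) (M.act x (proj M.carrier z v)) = M.act x (proj M.carrier z v) :=
    proj_of_mem (by rw [add_comm]; exact M.act_mem i z x hx _ (proj_mem _ v))
  rw [← h3, h2, map_smul, h4, map_add, h5, h6, add_zero]

theorem subsingleton_H1 {M : LieSuperModule.{u, v} L} {z : ZMod 2}
    (h : ∀ f ∈ M.cocycles z, f ∈ M.coboundaries z) : Subsingleton (M.H1 z) := by
  rw [Submodule.Quotient.subsingleton_iff, eq_top_iff]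
  exact fun f _ => h f.1 f.2

end LieSuperModule

/-! ### Ideals of the map superalgebra and the vanishing theorem for several points. -/

namespace MapSuperalgebra

variable {L : Type u} [AddCommGroup L] [Module ℂ L] [LieSuperalgebra L]
variable {A : Type w} [CommRing A] [Algebra ℂ A]

theorem bracket_mk (x y : L) (a b : A) :
    bracket (mk L A x a) (mk L A y b) = mk L A (bracket x y) (a * b) := rfl

theorem mk_mem_grade {z : ZMod 2} {x : L} (hx : x ∈ grade (V := L) z) (a : A) :
    mk L A x a ∈ grade (V := MapSuperalgebra L A) z :=
  mk_mem_gradeMap hx a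

theorem proj_mk (i : ZMod 2) (x : L) (a : A) :
    proj (MapSuperalgebra L A) i (mk L A x a) = mk L A (proj L i x) a := by
  conv_lhs => rw [← proj_add_proj x, map_add, LinearMap.add_apply, map_add]
  rcases zmod_two_cases i with rfl | rfl
  · rw [proj_of_mem (mk_mem_grade (proj_mem 0 x) a),
      proj_of_mem_ne (by decide) (mk_mem_grade (proj_mem 1 x) a), add_zero]
  · rw [proj_of_mem (mk_mem_grade (proj_mem 1 x) a),
      proj_of_mem_ne (by decide) (mk_mem_grade (proj_mem 0 x) a), zero_add]

variable (L) in
/-- The ideal `𝔤 ⊗ J` of `𝔤 ⊗ A`. -/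
def ideal (J : Ideal A) : Submodule ℂ (MapSuperalgebra L A) :=
  Submodule.map₂ (mk L A) ⊤ (J.restrictScalars ℂ)

theorem mk_mem_ideal {J : Ideal A} (x : L) {a : A} (ha : a ∈ J) : mk L A x a ∈ ideal L J :=
  Submodule.apply_mem_map₂ _ Submodule.mem_top ha

theorem ideal_le {J : Ideal A} {S : Submodule ℂ (MapSuperalgebra L A)}
    (h : ∀ x, ∀ a ∈ J, mk L A x a ∈ S) : ideal L J ≤ S :=
  Submodule.map₂_le.mpr fun x _ a ha => h x a ha

theorem isGraded_ideal (J : Ideal A) : IsGraded (ideal L J) := by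
  intro i t ht
  have : ideal L J ≤ (ideal L J).comap (proj (MapSuperalgebra L A) i) :=
    ideal_le fun x a ha => by
      rw [Submodule.mem_comap, proj_mk]
      exact mk_mem_ideal _ ha
  exact this ht

theorem bracket_mem_ideal {J : Ideal A} (s : MapSuperalgebra L A) {t : MapSuperalgebra L A}
    (ht : t ∈ ideal L J) : bracket s t ∈ ideal L J := by
  have : ideal L J ≤ (ideal L J).comap (bracket s) := by
    refine ideal_le fun y b hb => ?_
    rw [Submodule.mem_comap]
    induction s using induction_on with
    | hzero => simp
    | hadd s s' h h' => rw [map_add, LinearMap.add_apply]; exact add_mem h h'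
    | hmk x a => exact mk_mem_ideal _ (J.mul_mem_left a hb)
  exact this ht

theorem ideal_sup {J K : Ideal A} (h : J ⊔ K = ⊤) : ideal L J ⊔ ideal L K = ⊤ := by
  rw [Submodule.eq_top_iff']
  intro t
  induction t using induction_on with
  | hzero => exact zero_mem _
  | hadd s t hs ht => exact add_mem hs ht
  | hmk x a =>
    obtain ⟨b, hb, c, hc, rfl⟩ := Submodule.mem_sup.mp (h ▸ Submodule.mem_top : a ∈ J ⊔ K)
    rw [map_add]
    exact Submodule.add_mem_sup (mk_mem_ideal x hb) (mk_mem_ideal x hc)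

/-- A bracket of the two ideals lies in `𝔤 ⊗ (J ∩ K)`. The target of `F` is arbitrary so that this
serves both for the action and for a derivation. -/
theorem bracket_ideal_eq_zero {J K : Ideal A} {E : Type*} [AddCommGroup E] [Module ℂ E]
    (F : MapSuperalgebra L A →ₗ[ℂ] E) (hF : ∀ x : L, ∀ a ∈ J ⊓ K, F (mk L A x a) = 0)
    {s t : MapSuperalgebra L A} (hs : s ∈ ideal L J) (ht : t ∈ ideal L K) :
    F (bracket s t) = 0 := by
  have h1 : ∀ x : L, ∀ a ∈ J, ideal L K ≤ LinearMap.ker (F.comp (bracket (mk L A x a))) :=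
    fun x a ha => ideal_le fun y b hb =>
      hF _ _ ⟨J.mul_mem_right b ha, K.mul_mem_left a hb⟩
  have h2 : ideal L J ≤ LinearMap.ker (F.comp (bracket.flip t)) :=
    ideal_le fun x a ha => h1 x a ha ht
  exact h2 hs

theorem residue_eq_zero_iff [Algebra.FiniteType ℂ A] (m : MaximalSpectrum A) (a : A) :
    residue m a = 0 ↔ a ∈ m.asIdeal := by
  simp only [residue, AlgHom.comp_apply, AlgEquiv.coe_toAlgHom]
  rw [map_eq_zero_iff _ (AlgEquiv.injective _), Ideal.Quotient.mkₐ_eq_mk,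
    Ideal.Quotient.eq_zero_iff_mem]

theorem sup_iInf_ne_eq_top {n : ℕ} {m : Fin n → MaximalSpectrum A} (hm : Function.Injective m)
    (k : Fin n) : (m k).asIdeal ⊔ ⨅ j ∈ Finset.univ.erase k, (m j).asIdeal = ⊤ := by
  refine Ideal.sup_iInf_eq_top fun j hj => ?_
  refine (m k).isMaximal.coprime_of_ne (m j).isMaximal fun h => ?_
  exact Finset.ne_of_mem_erase hj (hm (MaximalSpectrum.ext h)).symm

theorem exists_residue_eq_single [Algebra.FiniteType ℂ A] {n : ℕ} {m : Fin n → MaximalSpectrum A}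
    (hm : Function.Injective m) (k : Fin n) :
    ∃ a : A, residue (m k) a = 1 ∧ ∀ j ≠ k, residue (m j) a = 0 := by
  obtain ⟨b, hb, a, ha, hab⟩ := Submodule.mem_sup.mp
    (sup_iInf_ne_eq_top hm k ▸ Submodule.mem_top :
      (1 : A) ∈ (m k).asIdeal ⊔ ⨅ j ∈ Finset.univ.erase k, (m j).asIdeal)
  refine ⟨a, ?_, fun j hj => ?_⟩
  · have := congrArg (residue (m k)) hab
    rwa [map_add, (residue_eq_zero_iff _ b).mpr hb, zero_add, map_one] at this
  · simp only [Submodule.mem_iInf] at ha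
    exact (residue_eq_zero_iff _ a).mpr (ha j (Finset.mem_erase.mpr ⟨hj, Finset.mem_univ j⟩))

theorem jointEvalHom_mk [Algebra.FiniteType ℂ A] {n : ℕ} (m : Fin n → MaximalSpectrum A) (x : L)
    (a : A) (k : Fin n) :
    (jointEvalHom L m).toLinearMap (mk L A x a) k = residue (m k) a • x :=
  evalLin_mk L (residue (m k)) x a

open LieSuperModule in
/-- A derivation into a module without invariants under `𝔤 ⊗ J` and under `𝔤 ⊗ K` kills
`𝔤 ⊗ (J ∩ K)` if this ideal acts trivially. -/
theorem derivation_mk_eq_zero {M : LieSuperModule.{max u w, v} (MapSuperalgebra L A)}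
    {F : MapSuperalgebra L A →ₗ[ℂ] M.carrier} (hF : M.IsDerivation F) {J K : Ideal A}
    (hJ : M.killed (ideal L J) = ⊥) (hK : M.killed (ideal L K) = ⊥)
    (hJK : ∀ x : L, ∀ a ∈ J ⊓ K, M.act (mk L A x a) = 0) (x : L) {a : A} (ha : a ∈ J ⊓ K) :
    F (mk L A x a) = 0 := by
  -- The second term of the derivation identity drops out because `t ⊗ c` acts by zero.
  have h1 : ∀ i j, ∀ s ∈ grade (V := L) i, ∀ t ∈ grade (V := L) j, ∀ b, ∀ c ∈ J ⊓ K,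
      F (mk L A (bracket s t) (b * c)) = M.act (mk L A s b) (F (mk L A t c)) := by
    intro i j s hs t ht b c hc
    have := hF i j _ (mk_mem_grade hs b) _ (mk_mem_grade ht c)
    rw [bracket_mk] at this
    rw [this, hJK t c hc, LinearMap.zero_apply, smul_zero, sub_zero]
  have h2 : ∀ i j, ∀ s ∈ grade (V := L) i, ∀ t ∈ grade (V := L) j, ∀ b ∈ J ⊓ K, ∀ c ∈ J ⊓ K,
      F (mk L A (bracket s t) (b * c)) = 0 := by
    intro i j s hs t ht b hb c hc
    rw [h1 i j s hs t ht b c hc, hJK s b hb, LinearMap.zero_apply]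
  have h3 : ∀ i, ∀ x ∈ grade (V := L) i, F (mk L A x a) = 0 := by
    intro i x hx
    -- Two applications of `h1` turn `(s ⊗ b)(t ⊗ c) F(x ⊗ a)` into `F([s, [t, x]] ⊗ bca)`. Here
    -- `bc` and `a` both lie in `J ∩ K`, so `h2` applies.
    have e1 : ∀ t, ∀ c ∈ K, M.act (mk L A t c) (F (mk L A x a)) ∈ M.killed (ideal L J) := by
      intro t c hc
      have : ideal L J ≤ LinearMap.ker
          (M.act.flip (M.act (mk L A t c) (F (mk L A x a)))) := by
        refine ideal_le fun s b hb => ?_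
        change M.act (mk L A s b) (M.act (mk L A t c) (F (mk L A x a))) = 0
        induction t using homogeneous_induction with
        | hadd t t' h h' => simp only [map_add, LinearMap.add_apply, h, h', add_zero]
        | hhom j t ht =>
          induction s using homogeneous_induction with
          | hadd s s' h h' => simp only [map_add, LinearMap.add_apply, h, h', add_zero]
          | hhom k s hs =>
            rw [← h1 j i t ht x hx c a ha, ← h1 k (j + i) s hs _ (bracket_mem j i t ht x hx) b _
              ((J ⊓ K).mul_mem_left c ha), ← mul_assoc]
            have hbc : b * c ∈ J ⊓ K := ⟨J.mul_mem_right c hb, K.mul_mem_left b hc⟩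
            exact h2 k (j + i) s hs _ (bracket_mem j i t ht x hx) _ hbc a ha
      rw [mem_killed]
      exact fun s hs => this hs
    have e2 : F (mk L A x a) ∈ M.killed (ideal L K) := by
      have : ideal L K ≤ LinearMap.ker (M.act.flip (F (mk L A x a))) := by
        refine ideal_le fun t c hc => ?_
        have := e1 t c hc
        rwa [hJ, Submodule.mem_bot] at this
      rw [mem_killed]
      exact fun s hs => this hs
    rwa [hK, Submodule.mem_bot] at e2
  rw [← proj_add_proj x, map_add, LinearMap.add_apply, map_add, h3 0 _ (proj_mem 0 x),
    h3 1 _ (proj_mem 1 x), add_zero]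

-- Nontrivial action of each ideal removes its invariants by irreducibility; this makes a cocycle
-- vanish on `𝔤 ⊗ (J ∩ K)`, which supplies the hypotheses of `IsDerivation.exists_eq_inner`.
open LieSuperModule in
theorem subsingleton_H1_of_sup_eq_top {M : LieSuperModule.{max u w, v} (MapSuperalgebra L A)}
    [FiniteDimensional ℂ M.carrier] (hM : M.IsIrreducible) {J K : Ideal A} (htop : J ⊔ K = ⊤)
    (hJK : ∀ x : L, ∀ a ∈ J ⊓ K, M.act (mk L A x a) = 0)
    (hJ : ∃ x : L, ∃ a ∈ J, M.act (mk L A x a) ≠ 0)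
    (hK : ∃ x : L, ∃ a ∈ K, M.act (mk L A x a) ≠ 0) (z : ZMod 2) : Subsingleton (M.H1 z) := by
  obtain ⟨x, a, ha, hxa⟩ := hJ
  obtain ⟨y, b, hb, hyb⟩ := hK
  have hJ := killed_eq_bot hM (isGraded_ideal J) (fun s _ => bracket_mem_ideal s)
    (mk_mem_ideal x ha) hxa
  have hK := killed_eq_bot hM (isGraded_ideal K) (fun s _ => bracket_mem_ideal s)
    (mk_mem_ideal y hb) hyb
  refine subsingleton_H1 fun f hf => ?_
  have hF := isDerivation_untwist hf
  obtain ⟨v, hv⟩ := hF.exists_eq_inner hM (isGraded_ideal J) (isGraded_ideal K)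
    (fun s hs t ht => bracket_ideal_eq_zero M.act hJK hs ht)
    (fun s hs t ht => bracket_ideal_eq_zero _
      (fun x a ha => derivation_mk_eq_zero hF hJ hK hJK x ha) hs ht)
    (ideal_sup htop) hJ hK
  exact mem_coboundaries_of_untwist_eq_inner hf hv

open LieSuperModule in
theorem subsingleton_H1_of_isIteratedProduct [Algebra.FiniteType ℂ A]
    {V : LieSuperModule (MapSuperalgebra L A)} (hVfin : FiniteDimensional ℂ V.carrier)
    (hVirr : V.IsIrreducible) {n : ℕ} (hn : 1 < n) {m : Fin n → MaximalSpectrum A}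
    (hm : Function.Injective m) {W : Fin n → LieSuperModule L} (hW : ∀ k, ¬ (W k).IsTrivial)
    {P : LieSuperModule (Fin n → L)} (hP : IsIteratedProduct n W P)
    (hV : V.Iso (P.pullback (jointEvalHom L m))) (z : ZMod 2) : Subsingleton (V.H1 z) := by
  have hact : ∀ t, V.act t = 0 ↔ P.act ((jointEvalHom L m).toLinearMap t) = 0 := by
    intro t
    constructor
    · intro h
      ext p
      exact act_eq_zero_of_isoToSubmodule hV h
        (s := (p : (P.pullback (jointEvalHom L m)).carrier)) Submodule.mem_top
    · intro h
      obtain ⟨f, hinj, -, -, hf⟩ := hV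
      ext v
      refine hinj ((hf t v).trans ?_)
      rw [LinearMap.zero_apply, map_zero]
      change P.act ((jointEvalHom L m).toLinearMap t) (f v) = 0
      rw [h]
      rfl
  -- An element `a` that is `1` at the `k`-th point and `0` at the others sends `x ⊗ a` to `x` in
  -- the `k`-th summand.
  have hsingle : ∀ k, ∃ x : L, ∃ a : A, (residue (m k) a = 1 ∧ ∀ j ≠ k, residue (m j) a = 0) ∧
      V.act (mk L A x a) ≠ 0 := by
    intro k
    obtain ⟨_, x, -, hx⟩ := hP.exists_act_single_ne_zero hW k
    obtain ⟨a, ha⟩ := exists_residue_eq_single hm k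
    refine ⟨x, a, ha, fun h => hx ?_⟩
    rw [hact] at h
    rw [← h]
    congr 1
    ext j
    rw [jointEvalHom_mk]
    by_cases hj : j = k
    · subst hj; simp [ha.1]
    · simp [ha.2 j hj, hj]
  set k₀ : Fin n := ⟨0, by omega⟩
  set k₁ : Fin n := ⟨1, hn⟩
  have hk : k₁ ≠ k₀ := by simp [k₀, k₁]
  -- Here `J` is the ideal of the point `k₀` and `K` that of all the others. Nontriviality of `J` is
  -- seen at the second point `k₁`, which exists because `1 < n`; nontriviality of `K` is seen at
  -- `k₀`.
  refine subsingleton_H1_of_sup_eq_top hVirr (sup_iInf_ne_eq_top hm k₀) (fun x a ha => ?_) ?_ ?_ z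
  · rw [hact]
    have : (jointEvalHom L m).toLinearMap (mk L A x a) = 0 := by
      ext j
      rw [jointEvalHom_mk, Pi.zero_apply]
      have hj : a ∈ (m j).asIdeal := by
        by_cases hj : j = k₀
        · exact hj ▸ ha.1
        · have h2 : a ∈ ⨅ j ∈ Finset.univ.erase k₀, (m j).asIdeal := ha.2
          simp only [Submodule.mem_iInf] at h2
          exact h2 j (Finset.mem_erase.mpr ⟨hj, Finset.mem_univ j⟩)
      rw [(residue_eq_zero_iff _ a).mpr hj, zero_smul]
    rw [this, map_zero]
  · obtain ⟨x, a, ha, hx⟩ := hsingle k₁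
    exact ⟨x, a, (residue_eq_zero_iff _ a).mp (ha.2 k₀ hk.symm), hx⟩
  · obtain ⟨x, a, ha, hx⟩ := hsingle k₀
    refine ⟨x, a, ?_, hx⟩
    simp only [Submodule.mem_iInf]
    exact fun j hj => (residue_eq_zero_iff _ a).mp (ha.2 j (Finset.ne_of_mem_erase hj))

end MapSuperalgebra

/-! ### Perfectness of simple Lie superalgebras. -/

namespace LieSuperalgebra

/-- A simple Lie superalgebra is perfect. -/
theorem IsSimple.map₂_bracket_eq_top {L : Type u} [AddCommGroup L] [Module ℂ L] [LieSuperalgebra L]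
    (h : IsSimple L) : Submodule.map₂ (bracket (L := L)) ⊤ ⊤ = ⊤ := by
  obtain ⟨⟨x, y, hxy⟩, h⟩ := h
  have hmem : ∀ x y : L, bracket x y ∈ Submodule.map₂ (bracket (L := L)) ⊤ ⊤ := fun x y =>
    Submodule.apply_mem_map₂ _ Submodule.mem_top Submodule.mem_top
  -- The span of all brackets is a graded ideal, nonzero because the algebra is not abelian.
  refine (h _ (isGraded_of_parity fun v hv => ?_) fun x y _ => hmem x y).resolve_left fun h => hxy ?_
  · have : Submodule.map₂ (bracket (L := L)) ⊤ ⊤ ≤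
        (Submodule.map₂ (bracket (L := L)) ⊤ ⊤).comap (parity L) :=
      Submodule.map₂_le.mpr fun x _ y _ => by
        have e := (LieSuperModule.adjoint L).parity_act x y
        change parity L (bracket x y) = bracket (parity L x) (parity L y) at e
        rw [Submodule.mem_comap, e]
        exact hmem _ _
    exact this hv
  · simpa [h] using hmem x y

end LieSuperalgebra

/-! ### The cotangent space at a maximal ideal and point derivations. -/

namespace MaximalSpectrum

open MapSuperalgebra

variable {A : Type w} [CommRing A] [Algebra ℂ A] [Algebra.FiniteType ℂ A]

/-- Lifts of a basis of the cotangent space at a point, and the dual point derivations. -/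
theorem exists_dual_derivations (m : MaximalSpectrum A) :
    ∃ (t : Fin (Module.finrank (A ⧸ m.asIdeal) m.asIdeal.Cotangent) → A)
      (D : Fin (Module.finrank (A ⧸ m.asIdeal) m.asIdeal.Cotangent) → A →ₗ[ℂ] ℂ),
      (∀ j, t j ∈ m.asIdeal) ∧ (∀ j k, D j (t k) = if j = k then 1 else 0) ∧
      (∀ j, D j 1 = 0) ∧
      (∀ j a b, D j (a * b) = residue m a * D j b + residue m b * D j a) ∧
      ∀ a, a - (residue m a • (1 : A) + ∑ j, D j a • t j) ∈ m.asIdeal ^ 2 := by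
  have := m.isMaximal
  have : IsNoetherianRing A := Algebra.FiniteType.isNoetherianRing ℂ A
  have : Module.Finite A m.asIdeal.Cotangent :=
    Module.Finite.of_surjective _ m.asIdeal.toCotangent_surjective
  have htower : IsScalarTower ℂ (A ⧸ m.asIdeal) m.asIdeal.Cotangent := by
    refine ⟨fun c q x => ?_⟩
    obtain ⟨a, rfl⟩ := Ideal.Quotient.mk_surjective q
    have h1 : c • Ideal.Quotient.mk m.asIdeal a = algebraMap A (A ⧸ m.asIdeal) (c • a) := rfl
    have h2 : Ideal.Quotient.mk m.asIdeal a = algebraMap A (A ⧸ m.asIdeal) a := rfl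
    rw [h1, h2, algebraMap_smul, algebraMap_smul, smul_assoc]
  have hfin : Module.Finite (A ⧸ m.asIdeal) m.asIdeal.Cotangent :=
    Module.Finite.of_restrictScalars_finite A _ _
  have hfree : Module.Free (A ⧸ m.asIdeal) m.asIdeal.Cotangent := by
    let _ : Field (A ⧸ m.asIdeal) := Ideal.Quotient.field m.asIdeal
    infer_instance
  let B := Module.finBasis (A ⧸ m.asIdeal) m.asIdeal.Cotangent
  let ρ : (A ⧸ m.asIdeal) ≃ₐ[ℂ] ℂ := (AlgEquiv.ofBijective _ (residue_bijective A m)).symm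
  have hρ : ∀ a, ρ (algebraMap A (A ⧸ m.asIdeal) a) = residue m a := fun _ => rfl
  choose t ht using fun j => m.asIdeal.toCotangent_surjective (B j)
  have hmem : ∀ a, a - algebraMap ℂ A (residue m a) ∈ m.asIdeal := fun a => by
    rw [← residue_eq_zero_iff, map_sub, AlgHom.commutes]
    exact sub_self _
  -- The universal point derivation: `a` goes to the class of `a - χ(a)` in `m / m²`. The `D j` are
  -- its coordinates.
  let δ : A →ₗ[ℂ] m.asIdeal.Cotangent :=
    (m.asIdeal.toCotangent.restrictScalars ℂ).comp
      (LinearMap.codRestrict (m.asIdeal.restrictScalars ℂ)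
        (LinearMap.id - (Algebra.linearMap ℂ A).comp (residue m).toLinearMap) hmem)
  have hδ : ∀ a, δ a = m.asIdeal.toCotangent ⟨_, hmem a⟩ := fun _ => rfl
  let D : Fin (Module.finrank (A ⧸ m.asIdeal) m.asIdeal.Cotangent) → A →ₗ[ℂ] ℂ := fun j =>
    ρ.toLinearMap.comp (((B.coord j).restrictScalars ℂ).comp δ)
  have hD : ∀ j a, D j a = ρ (B.repr (δ a) j) := fun _ _ => rfl
  have hδm : ∀ a (ha : a ∈ m.asIdeal), δ a = m.asIdeal.toCotangent ⟨a, ha⟩ := by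
    intro a ha
    rw [hδ]
    congr 2
    rw [(residue_eq_zero_iff m a).mpr ha, map_zero, sub_zero]
  refine ⟨fun j => t j, D, fun j => (t j).2, fun j k => ?_, fun j => ?_, fun j a b => ?_,
    fun a => ?_⟩
  · rw [hD, hδm _ (t k).2, ht, B.repr_self, Finsupp.single_apply]
    simp only [eq_comm (a := k)]
    split_ifs <;> simp
  · have : δ 1 = 0 := by
      rw [hδ, Ideal.toCotangent_eq_zero]
      simp
    rw [hD, this]
    simp
  · have : δ (a * b) = a • δ b + b • δ a := by
      rw [hδ, hδ, hδ, ← map_smul, ← map_smul, ← map_add, Ideal.toCotangent_eq]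
      -- The defect of the Leibniz rule is exactly `-(a - χ(a)) (b - χ(b))`, which lies in `m²`.
      have h := Ideal.mul_mem_mul (hmem a) (hmem b)
      rw [← pow_two] at h
      have h' := neg_mem h
      simp only [Submodule.coe_add, Submodule.coe_smul, smul_eq_mul, map_mul]
      convert h' using 1
      ring
    rw [hD, this, ← algebraMap_smul (A ⧸ m.asIdeal) a, ← algebraMap_smul (A ⧸ m.asIdeal) b]
    simp only [map_add, map_smul, Finsupp.add_apply, Finsupp.smul_apply, smul_eq_mul, map_mul,
      hρ, ← hD]
  · have hs : ∀ j, D j a • (t j : A) ∈ m.asIdeal := fun j =>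
      Submodule.smul_of_tower_mem _ _ (t j).2
    -- Expansion of `δ a` in the basis; equality of classes in `m / m²` is the required congruence.
    have key : m.asIdeal.toCotangent ⟨_, hmem a⟩ =
        m.asIdeal.toCotangent (∑ j, algebraMap ℂ A (D j a) • t j) := by
      rw [map_sum, ← hδ, ← B.sum_repr (δ a)]
      refine Finset.sum_congr rfl fun j _ => ?_
      rw [map_smul, ht, ← algebraMap_smul (A ⧸ m.asIdeal) (algebraMap ℂ A (D j a))]
      congr 1
      apply ρ.injective
      rw [hρ, AlgHom.commutes, hD]
      simp
    rw [Ideal.toCotangent_eq] at key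
    convert key using 1
    rw [AddSubmonoidClass.coe_finsetSum]
    simp only [Submodule.coe_smul, smul_eq_mul, Algebra.smul_def, mul_one]
    ring

end MaximalSpectrum

/-! ### First cohomology at a single point. -/

namespace MapSuperalgebra

open LieSuperModule

variable {L : Type u} [AddCommGroup L] [Module ℂ L] [LieSuperalgebra L]
variable {A : Type w} [CommRing A] [Algebra ℂ A]

variable (L) in
/-- The linear map `x ⊗ a ↦ D(a) x` attached to a linear form `D` on `A`. -/
def contract (D : A →ₗ[ℂ] ℂ) : MapSuperalgebra L A →ₗ[ℂ] L :=
  TensorProduct.lift (LinearMap.flip ((LinearMap.lsmul ℂ L).comp D))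

theorem contract_mk (D : A →ₗ[ℂ] ℂ) (x : L) (a : A) : contract L D (mk L A x a) = D a • x := by
  simp only [contract, mk]
  exact TensorProduct.lift.tmul ..

section Point

variable {χ : A →ₐ[ℂ] ℂ} {M : LieSuperModule.{max u w, v} (MapSuperalgebra L A)}
variable {N : LieSuperModule.{u, v'} L}

/-- An isomorphism of `M` with the pull-back of `N` along the evaluation at a character. -/
structure EvalIso (χ : A →ₐ[ℂ] ℂ) (M : LieSuperModule.{max u w, v} (MapSuperalgebra L A))
    (N : LieSuperModule.{u, v'} L) where
  ofEquiv ::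
  toEquiv : M.carrier ≃ₗ[ℂ] N.carrier
  map_mem : ∀ i, ∀ v ∈ grade (V := M.carrier) i, toEquiv v ∈ grade (V := N.carrier) i
  map_act : ∀ x a v, toEquiv (M.act (mk L A x a) v) = χ a • N.act x (toEquiv v)

namespace EvalIso

theorem act_symm (E : EvalIso χ M N) (x : L) (a : A) (v : N.carrier) :
    M.act (mk L A x a) (E.toEquiv.symm v) = χ a • E.toEquiv.symm (N.act x v) := by
  apply E.toEquiv.injective
  rw [map_smul, E.map_act, E.toEquiv.apply_symm_apply, E.toEquiv.apply_symm_apply]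

theorem map_proj (E : EvalIso χ M N) (i : ZMod 2) (v : M.carrier) :
    E.toEquiv (proj M.carrier i v) = proj N.carrier i (E.toEquiv v) := by
  conv_rhs => rw [← proj_add_proj v, map_add, map_add]
  rcases zmod_two_cases i with rfl | rfl
  · rw [proj_of_mem (E.map_mem 0 _ (proj_mem 0 v)),
      proj_of_mem_ne (by decide) (E.map_mem 1 _ (proj_mem 1 v)), add_zero]
  · rw [proj_of_mem (E.map_mem 1 _ (proj_mem 1 v)),
      proj_of_mem_ne (by decide) (E.map_mem 0 _ (proj_mem 0 v)), zero_add]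

theorem symm_mem (E : EvalIso χ M N) {i : ZMod 2} {v : N.carrier}
    (hv : v ∈ grade (V := N.carrier) i) : E.toEquiv.symm v ∈ grade (V := M.carrier) i := by
  have : E.toEquiv.symm v = proj M.carrier i (E.toEquiv.symm v) := by
    apply E.toEquiv.injective
    rw [E.map_proj, E.toEquiv.apply_symm_apply, proj_of_mem hv]
  rw [this]
  exact proj_mem i _

/-- The map `x ↦ f(x ⊗ a)`. -/
def restrict (E : EvalIso χ M N) (a : A) :
    (MapSuperalgebra L A →ₗ[ℂ] M.carrier) →ₗ[ℂ] (L →ₗ[ℂ] N.carrier) :=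
  (LinearMap.lcomp ℂ N.carrier ((mk L A).flip a)).comp
    (LinearMap.llcomp ℂ _ _ _ E.toEquiv.toLinearMap)

theorem restrict_apply (E : EvalIso χ M N) (a : A) (f : MapSuperalgebra L A →ₗ[ℂ] M.carrier)
    (x : L) : E.restrict a f x = E.toEquiv (f (mk L A x a)) := rfl

variable {z : ZMod 2} {f : MapSuperalgebra L A →ₗ[ℂ] M.carrier}

theorem restrict_mem (E : EvalIso χ M N) (hf : f ∈ M.cocycles z) (a : A) {i : ZMod 2} {x : L}
    (hx : x ∈ grade (V := L) i) : E.restrict a f x ∈ grade (V := N.carrier) (z + i) :=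
  E.map_mem _ _ (hf.1 i _ (mk_mem_grade hx a))

/-- All three properties of the slices follow from this identity: take `a = b = 1`, or `a = 1` and
`χ(b) = 0`, or `χ(a) = χ(b) = 0`. -/
theorem restrict_mul (E : EvalIso χ M N) (hf : f ∈ M.cocycles z) (a b : A) {i j : ZMod 2}
    {x y : L} (hx : x ∈ grade (V := L) i) (hy : y ∈ grade (V := L) j) :
    E.restrict (a * b) f (bracket x y) = χ a • koszulSign z i • N.act x (E.restrict b f y) -
      χ b • koszulSign j (i + z) • N.act y (E.restrict a f x) := by
  have h := congrArg E.toEquiv (hf.2 i j _ (mk_mem_grade hx a) _ (mk_mem_grade hy b))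
  rw [bracket_mk, map_sub, map_smul, map_smul, E.map_act, E.map_act, smul_comm _ (χ a),
    smul_comm _ (χ b)] at h
  exact h

theorem restrict_one_mem_cocycles (E : EvalIso χ M N) (hf : f ∈ M.cocycles z) :
    E.restrict 1 f ∈ N.cocycles z := by
  refine ⟨fun i x hx => E.restrict_mem hf 1 hx, fun i j x hx y hy => ?_⟩
  have := E.restrict_mul hf 1 1 hx hy
  rwa [mul_one, map_one, one_smul, one_smul] at this

theorem restrict_mem_homs (E : EvalIso χ M N) (hf : f ∈ M.cocycles z) {a : A} (ha : χ a = 0) :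
    E.restrict a f ∈ homs (adjoint L) N z := by
  refine ⟨fun i x hx => E.restrict_mem hf a hx, fun i x hx y => ?_⟩
  change E.restrict a f (bracket x (y : L)) = koszulSign z i • N.act x (E.restrict a f (y : L))
  revert y
  change ∀ y : L, _
  intro y
  induction y using homogeneous_induction with
  | hadd y y' h h' => rw [map_add, map_add, map_add, h, h', map_add, smul_add]
  | hhom j y hy =>
    have := E.restrict_mul hf 1 a hx hy
    rwa [one_mul, map_one, one_smul, ha, zero_smul, sub_zero] at this

/-- For `b`, `c` in `I` both terms of `restrict_mul` vanish, so the slice at `b c` kills every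
bracket, hence everything by perfectness. -/
theorem restrict_eq_zero (E : EvalIso χ M N) (hL : IsSimple L) (hf : f ∈ M.cocycles z)
    {I : Ideal A} (hI : ∀ a ∈ I, χ a = 0) {a : A} (ha : a ∈ I ^ 2) : E.restrict a f = 0 := by
  rw [pow_two] at ha
  refine Submodule.mul_induction_on ha (fun b hb c hc => ?_) fun b c hb hc => ?_
  · have key : Submodule.map₂ (bracket (L := L)) ⊤ ⊤ ≤ LinearMap.ker (E.restrict (b * c) f) := by
      refine Submodule.map₂_le.mpr fun x _ y _ => ?_
      rw [LinearMap.mem_ker]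
      induction x using homogeneous_induction with
      | hadd x x' h h' =>
        rw [map_add, LinearMap.add_apply, map_add, h Submodule.mem_top, h' Submodule.mem_top,
          add_zero]
      | hhom i x hx =>
        induction y using homogeneous_induction with
        | hadd y y' h h' =>
          rw [map_add, map_add, h Submodule.mem_top, h' Submodule.mem_top, add_zero]
        | hhom j y hy =>
          rw [E.restrict_mul hf b c hx hy, hI b hb, hI c hc, zero_smul, zero_smul, sub_zero]
    rw [hL.map₂_bracket_eq_top] at key
    ext x
    exact key Submodule.mem_top
  · ext x
    have h1 := congrArg (· x) hb
    have h2 := congrArg (· x) hc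
    simp only [restrict_apply, LinearMap.zero_apply] at h1 h2 ⊢
    rw [map_add, map_add, map_add, h1, h2, add_zero]

/-- The map `x ⊗ a ↦ D(a) g(x)`. -/
def extend (E : EvalIso χ M N) (D : A →ₗ[ℂ] ℂ) (g : L →ₗ[ℂ] N.carrier) :
    MapSuperalgebra L A →ₗ[ℂ] M.carrier :=
  E.toEquiv.symm.toLinearMap.comp (g.comp (contract L D))

theorem extend_mk (E : EvalIso χ M N) (D : A →ₗ[ℂ] ℂ) (g : L →ₗ[ℂ] N.carrier) (x : L) (a : A) :
    E.extend D g (mk L A x a) = D a • E.toEquiv.symm (g x) := by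
  simp only [extend, LinearMap.comp_apply, contract_mk, map_smul]
  rfl

theorem restrict_extend (E : EvalIso χ M N) (D : A →ₗ[ℂ] ℂ) (g : L →ₗ[ℂ] N.carrier) (a : A) :
    E.restrict a (E.extend D g) = D a • g := by
  ext x
  rw [restrict_apply, extend_mk, map_smul, E.toEquiv.apply_symm_apply, LinearMap.smul_apply]

/-- It suffices to check the cocycle identity on pure tensors. -/
theorem extend_mem_cocycles (E : EvalIso χ M N) {D : A →ₗ[ℂ] ℂ} {g : L →ₗ[ℂ] N.carrier}
    (hg : ∀ i, ∀ x ∈ grade (V := L) i, g x ∈ grade (V := N.carrier) (z + i))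
    (h : ∀ i j, ∀ x ∈ grade (V := L) i, ∀ y ∈ grade (V := L) j, ∀ a b,
      D (a * b) • g (bracket x y) = (D b * χ a) • koszulSign z i • N.act x (g y) -
        (D a * χ b) • koszulSign j (i + z) • N.act y (g x)) : E.extend D g ∈ M.cocycles z := by
  refine ⟨fun i s hs => ?_, fun i j s hs t ht => ?_⟩
  · refine grade_induction (P := fun s => E.extend D g s ∈ grade (V := M.carrier) (z + i))
      ?_ ?_ ?_ hs
    · rw [map_zero]; exact zero_mem _
    · intro s t hs ht; rw [map_add]; exact add_mem hs ht
    · intro x hx a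
      rw [extend_mk]
      exact Submodule.smul_mem _ _ (E.symm_mem (hg i x hx))
  · refine grade_induction (P := fun s => E.extend D g (bracket s t) =
      koszulSign z i • M.act s (E.extend D g t) -
        koszulSign j (i + z) • M.act t (E.extend D g s)) ?_ ?_ ?_ hs
    · simp
    · intro s s' h h'
      simp only [map_add, LinearMap.add_apply, h, h', smul_add]
      abel
    · intro x hx a
      refine grade_induction (P := fun t => E.extend D g (bracket (mk L A x a) t) =
        koszulSign z i • M.act (mk L A x a) (E.extend D g t) -
          koszulSign j (i + z) • M.act t (E.extend D g (mk L A x a))) ?_ ?_ ?_ ht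
      · simp
      · intro s s' h h'
        simp only [map_add, LinearMap.add_apply, h, h', smul_add]
        abel
      · intro y hy b
        rw [bracket_mk, extend_mk, extend_mk, extend_mk, ← map_smul, h i j x hx y hy, map_smul,
          map_smul, E.act_symm, E.act_symm, map_sub]
        simp only [map_smul, smul_smul]
        congr 2 <;> ring

theorem extend_cocycle_mem_cocycles (E : EvalIso χ M N) {g : L →ₗ[ℂ] N.carrier}
    (hg : g ∈ N.cocycles z) : E.extend χ.toLinearMap g ∈ M.cocycles z := by
  refine E.extend_mem_cocycles hg.1 fun i j x hx y hy a b => ?_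
  rw [hg.2 i j x hx y hy, smul_sub]
  simp only [AlgHom.toLinearMap_apply, map_mul, mul_comm (χ b)]

/-- By skew symmetry `g([x, y])` equals both `± x g(y)` and `∓ y g(x)`; the two Leibniz terms of `D
(a * b)` are matched with these two expressions. -/
theorem extend_hom_mem_cocycles (E : EvalIso χ M N) {D : A →ₗ[ℂ] ℂ}
    (hD : ∀ a b, D (a * b) = χ a * D b + χ b * D a) {g : L →ₗ[ℂ] N.carrier}
    (hg : g ∈ homs (adjoint L) N z) : E.extend D g ∈ M.cocycles z := by
  refine E.extend_mem_cocycles hg.1 fun i j x hx y hy a b => ?_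
  have h1 : g (bracket x y) = koszulSign z i • N.act x (g y) := hg.2 i x hx y
  have h2 : g (bracket y x) = koszulSign z j • N.act y (g x) := hg.2 j y hy x
  have h3 : g (bracket x y) = -(koszulSign j (i + z) • N.act y (g x)) := by
    rw [bracket_skew i j x hx y hy, map_neg, map_smul, h2, smul_smul]
    rcases zmod_two_cases i with rfl | rfl <;> rcases zmod_two_cases j with rfl | rfl <;>
      rcases zmod_two_cases z with rfl | rfl <;> simp [zmod_one_add_one]
  rw [hD, add_smul, mul_comm (D b), mul_comm (D a), sub_eq_add_neg, ← smul_neg, ← h3, ← h1]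

/-- The first cohomology of `𝔤 ⊗ A` with values in the pull-back of a `𝔤`-module along
the evaluation at a point, given lifts `t` of a basis of the cotangent space and the dual
point derivations `D`. -/
theorem nonempty_H1_equiv (E : EvalIso χ M N) (hL : IsSimple L) {I : Ideal A}
    (hI : ∀ a ∈ I, χ a = 0) {d : ℕ} {t : Fin d → A} {D : Fin d → A →ₗ[ℂ] ℂ}
    (ht : ∀ j, t j ∈ I) (hDt : ∀ j k, D j (t k) = if j = k then 1 else 0) (hD1 : ∀ j, D j 1 = 0)
    (hD : ∀ j a b, D j (a * b) = χ a * D j b + χ b * D j a)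
    (hsq : ∀ a, a - (χ a • (1 : A) + ∑ j, D j a • t j) ∈ I ^ 2) (z : ZMod 2) :
    Nonempty (M.H1 z ≃ₗ[ℂ] N.H1 z × (Fin d → homs (adjoint L) N z)) := by
  -- A cocycle is sent to the class of its slice at `1` and its slices at the `t j`.
  let Φ : M.cocycles z →ₗ[ℂ] N.H1 z × (Fin d → homs (adjoint L) N z) :=
    LinearMap.prod
      ((Submodule.mkQ _).comp (LinearMap.restrict (E.restrict 1)
        fun f hf => E.restrict_one_mem_cocycles hf))
      (LinearMap.pi fun j => LinearMap.restrict (E.restrict (t j))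
        fun f hf => E.restrict_mem_homs hf (hI _ (ht j)))
  have hsurj : Function.Surjective Φ := by
    rintro ⟨q, h⟩
    obtain ⟨g, rfl⟩ := Submodule.mkQ_surjective _ q
    let h' : Fin d → L →ₗ[ℂ] N.carrier := fun j => (h j).1
    -- The pieces do not interfere: `D j 1 = 0` and `χ (t k) = 0`, while `D j (t k)` is the
    -- Kronecker delta.
    refine ⟨⟨E.extend χ.toLinearMap g.1 + ∑ j, E.extend (D j) (h' j),
      add_mem (E.extend_cocycle_mem_cocycles g.2)
        (sum_mem fun j _ => E.extend_hom_mem_cocycles (hD j) (h j).2)⟩, Prod.ext ?_ ?_⟩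
    · refine congrArg (Submodule.mkQ _) (Subtype.ext ?_)
      change E.restrict 1 (_ + _) = _
      simp only [map_add, map_sum, restrict_extend, hD1]
      simp
    · funext k
      refine Subtype.ext ?_
      change E.restrict (t k) (_ + _) = h' k
      simp only [map_add, map_sum, restrict_extend, hDt]
      simp [hI _ (ht k)]
  have hker : LinearMap.ker Φ = (M.coboundaries z).submoduleOf (M.cocycles z) := by
    ext f
    change Φ f = 0 ↔ f.1 ∈ M.coboundaries z
    rw [Prod.ext_iff]
    have hΦ1 : (Φ f).1 = 0 ↔ E.restrict 1 f.1 ∈ N.coboundaries z :=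
      (Submodule.Quotient.mk_eq_zero _).trans Iff.rfl
    have hΦ2 : (Φ f).2 = 0 ↔ ∀ j, E.restrict (t j) f.1 = 0 := by
      rw [funext_iff]
      exact forall_congr' fun j => Subtype.ext_iff
    rw [Prod.fst_zero, Prod.snd_zero, hΦ1, hΦ2]
    constructor
    · rintro ⟨⟨v, hv, h1⟩, h2⟩
      refine ⟨E.toEquiv.symm v, E.symm_mem hv, fun i s hs => ?_⟩
      refine grade_induction (P := fun s => f.1 s = koszulSign z i • M.act s (E.toEquiv.symm v))
        ?_ ?_ ?_ hs
      · simp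
      · intro s s' h h'; rw [map_add, map_add, LinearMap.add_apply, h, h', smul_add]
      · intro x hx a
        rw [E.act_symm, smul_comm, ← map_smul, ← h1 i x hx, restrict_apply,
          E.toEquiv.symm_apply_apply]
        -- Modulo `I ^ 2`, `a` is `χ(a) + ∑ D_j(a) t_j`; the slices at `I ^ 2` and at the `t j`
        -- vanish, leaving `f(x ⊗ a) = χ(a) f(x ⊗ 1)`.
        have h3 := congrArg (· x) (E.restrict_eq_zero hL f.2 hI (hsq a))
        simp only [restrict_apply, LinearMap.zero_apply, map_sub, map_add, map_sum, map_smul] at h3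
        have h4 : ∀ j, E.toEquiv (f.1 (mk L A x (t j))) = 0 := fun j => congrArg (· x) (h2 j)
        simp only [h4, smul_zero, Finset.sum_const_zero, add_zero] at h3
        rw [← map_smul] at h3
        exact E.toEquiv.injective (sub_eq_zero.mp h3)
    · rintro ⟨v, hv, h⟩
      refine ⟨⟨E.toEquiv v, E.map_mem z v hv, fun i x hx => ?_⟩, fun j => ?_⟩
      · rw [restrict_apply, h i _ (mk_mem_grade hx 1), map_smul, E.map_act, map_one, one_smul]
      · have h0 : ∀ i, ∀ x ∈ grade (V := L) i, E.restrict (t j) f.1 x = 0 := fun i x hx => by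
          rw [restrict_apply, h i _ (mk_mem_grade hx _), map_smul, E.map_act, hI _ (ht j),
            zero_smul, smul_zero]
        ext x
        rw [← proj_add_proj x, map_add, h0 0 _ (proj_mem 0 x), h0 1 _ (proj_mem 1 x), add_zero,
          LinearMap.zero_apply]
  exact ⟨(Submodule.quotEquivOfEq _ _ hker.symm).trans (Φ.quotKerEquivOfSurjective hsurj)⟩

end EvalIso

end Point

theorem nonempty_evalIso [Algebra.FiniteType ℂ A] {V : LieSuperModule (MapSuperalgebra L A)}
    {m : Fin 1 → MaximalSpectrum A} {W : Fin 1 → LieSuperModule L}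
    {P : LieSuperModule (Fin 1 → L)} (hP : IsIteratedProduct 1 W P)
    (hV : V.Iso (P.pullback (jointEvalHom L m))) :
    Nonempty (EvalIso (residue (m 0)) V (W 0)) := by
  obtain ⟨f, hf, hfr, hfg, hfa⟩ := hV
  obtain ⟨g, hg, hgr, hgg, hga⟩ := hP
  let f' : V.carrier →ₗ[ℂ] P.carrier := f
  let g' : P.carrier →ₗ[ℂ] (W 0).carrier := g
  have hf' : Function.Bijective f' := ⟨hf, LinearMap.range_eq_top.mp hfr⟩
  have hg' : Function.Bijective g' := ⟨hg, LinearMap.range_eq_top.mp hgr⟩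
  refine ⟨⟨LinearEquiv.ofBijective (g'.comp f') (hg'.comp hf'),
    fun i v hv => hgg i _ (hfg i v hv), fun x a v => ?_⟩⟩
  have h1 : f' (V.act (mk L A x a) v) =
      P.act ((jointEvalHom L m).toLinearMap (mk L A x a)) (f' v) := hfa _ v
  have h2 : ∀ y p, g' (P.act y p) = (W 0).act (y 0) (g' p) := hga
  change g' (f' (V.act (mk L A x a) v)) = residue (m 0) a • (W 0).act x (g' (f' v))
  rw [h1, h2, jointEvalHom_mk, map_smul, LinearMap.smul_apply]

end MapSuperalgebra

end

theorem mainTheorem8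
    (𝔤 : Type*) [AddCommGroup 𝔤] [Module ℂ 𝔤] [LieSuperalgebra 𝔤] [FiniteDimensional ℂ 𝔤]
    (h𝔤 : LieSuperalgebra.IsSimple 𝔤)
    (A : Type*) [CommRing A] [Algebra ℂ A] [Algebra.FiniteType ℂ A]
    (V : LieSuperModule (MapSuperalgebra 𝔤 A)) (hVfin : FiniteDimensional ℂ V.carrier)
    (hVirr : V.IsIrreducible)
    (ℓ : ℕ) (hℓ : 0 < ℓ) (m : Fin ℓ → MaximalSpectrum A) (hm : Function.Injective m)
    (W : Fin ℓ → LieSuperModule 𝔤) (hWfin : ∀ k, FiniteDimensional ℂ (W k).carrier)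
    (hWirr : ∀ k, (W k).IsIrreducible) (hWnontriv : ∀ k, ¬ (W k).IsTrivial)
    (P : LieSuperModule (Fin ℓ → 𝔤)) (hP : LieSuperModule.IsIteratedProduct ℓ W P)
    (hV : V.Iso (P.pullback (MapSuperalgebra.jointEvalHom 𝔤 m))) :
    (ℓ = 1 → ∀ z : ZMod 2, Nonempty
      (V.H1 z ≃ₗ[ℂ] (W ⟨0, hℓ⟩).H1 z ×
        (Fin (Module.finrank (A ⧸ (m ⟨0, hℓ⟩).asIdeal) (m ⟨0, hℓ⟩).asIdeal.Cotangent) →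
          LieSuperModule.homs (LieSuperModule.adjoint 𝔤) (W ⟨0, hℓ⟩) z))) ∧
    (1 < ℓ → ∀ z : ZMod 2, Subsingleton (V.H1 z)) := by
  refine ⟨?_, fun h z => MapSuperalgebra.subsingleton_H1_of_isIteratedProduct hVfin hVirr h hm
    hWnontriv hP hV z⟩
  rintro rfl z
  obtain ⟨E⟩ := MapSuperalgebra.nonempty_evalIso hP hV
  obtain ⟨t, D, ht, hDt, hD1, hD, hsq⟩ := (m 0).exists_dual_derivations
  exact E.nonempty_H1_equiv h𝔤 (fun a ha => (MapSuperalgebra.residue_eq_zero_iff (m 0) a).mpr ha)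
    ht hDt hD1 hD hsq z
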